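/- Write $e(\theta)=e^{2\pi i\theta}$ and let $d_k$ be the $k$-fold divisor function. **Definition.** For an integer $k\ge 1$ and a real number $\alpha\ge 0$, the class $\mathcal F_k(\alpha)$ consists of the multiplicative functions $f\colon\mathbb N\to\mathbb C$ such that: 1. $|f(n)|\le d_k(n)$ for all $n$. 2. For every $q\ge 1$ and every Dirichlet character $\chi$ modulo $q$, the series $L(f,\chi,s)=\sum_{n\ge1} f(n)\chi(n)n^{-s}$ ($\Re s>1$) has an analytic continuation to $\Re s>1/2$, holomorphic except for at most a simple pole at $s=1$, which can occur only if $\chi$ is principal. It has no zero with $\Re s\ge 1$. It extends continuously to the line $\Re s=1/2$ and is of finite order: $|L(f,\chi,s)|\le B\exp(|\Im s|^{A})$ for $\Re s\ge 1/2$, $|\Im s|\ge1$, with some $A,B$ that may depend on $f$ and $\chi$. 3. For every $\varepsilon>0$ there is a constant $C$ (depending only on $f,\alpha,\varepsilon$) such that for all $q\ge 1$, all $\chi$ modulo $q$ and all real $T\ge1$, $$\int_{-T}^{T}\left|L(f,\chi,1/2+it)\right|^2dt\le C\,q^{\varepsilon^2}(1+T)^{1+\alpha+\varepsilon^2}.$$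 **Theorem.** Let $k\ge1$, $\varepsilon>0$ and $g\colon\mathbb N\to\mathbb C$. (a) Let $0\le\alpha<1$ and $g\in\mathcal F_k(\alpha)$. There are constants $C,K>0$, depending only on $g,k,\alpha,\varepsilon$, such that for all $0<\eta<1$, all integers $0\le a<q$, all real $X>q$, $x\in[X,2X]$, $1\le H\le X$ and $|\gamma|<1$ with $|\gamma|H^{\eta-\varepsilon/2}\ge K$, $$\Bigl|\sum_{x\le m\le x+H}g(m)\,e\bigl(m(\tfrac aq+\gamma)\bigr)\Bigr|\le C\Bigl((q|\gamma|X)^{(1+\alpha)/2+\varepsilon^2}H^{1/2}+\sum_{x-H^\eta\le m\le x}d_k(m)+\sum_{x+H\le m\le x+H+H^\eta}d_k(m)\Bigr).$$ (b) Let $g\in\mathcal F_k(0)$. There are constants $C,K>0$, depending only on $g,k,\varepsilon$, such that under the same conditions on $\eta,a,q,X,x,H,\gamma$, $$\Bigl|\sum_{x\le m\le x+H}g(m)\,e\bigl(m(\tfrac aq+\gamma)\bigr)\Bigr|\le C\Bigl((q|\gamma|X)^{1/2+\varepsilon^2}H^{1/2}+H^\eta(\log X)^{k^2-1}\Bigr).$$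 -/

import Mathlib

/-- `e(θ) = exp(2πiθ)`. -/
noncomputable def expE (θ : ℝ) : ℂ :=
  Complex.exp (2 * (Real.pi : ℂ) * Complex.I * (θ : ℂ))

/-- The `k`-fold divisor function `d_k`: the `k`-fold Dirichlet convolution `1 * ⋯ * 1`. -/
def divisorK (k : ℕ) : ArithmeticFunction ℕ :=
  ArithmeticFunction.zeta ^ k

/-- `Λ` is the analytic continuation of `L(f, χ, s) = ∑ f(n) χ(n) n^{-s}` to `Re s > 1/2`, with
boundary values on `Re s = 1/2`: it is holomorphic for `Re s > 1/2` except for at most a simple pole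
at `s = 1`, which occurs only for principal `χ`; it is continuous up to the line `Re s = 1/2`, of
finite order, and has no zero with `Re s ≥ 1`. The condition at the point `s = 1` itself is stated
through the order of the Laurent expansion, so that the value `Λ 1` plays no role. -/
structure IsLContinuation (f : ArithmeticFunction ℂ) {q : ℕ} (χ : DirichletCharacter ℂ q)
    (Λ : ℂ → ℂ) : Prop where
  eq_LSeries : ∀ s : ℂ, 1 < s.re → Λ s = LSeries (fun n : ℕ => f n * χ (n : ZMod q)) s
  holomorphic : DifferentiableOn ℂ Λ ({s : ℂ | 1 / 2 < s.re} \ {1})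
  continuous_boundary : ContinuousOn Λ ({s : ℂ | 1 / 2 ≤ s.re} \ {1})
  meromorphic_one : MeromorphicAt Λ 1
  order_one_principal : χ = 1 → -1 ≤ meromorphicOrderAt Λ 1
  order_one_nonprincipal : χ ≠ 1 → 0 ≤ meromorphicOrderAt Λ 1
  ne_zero : ∀ s : ℂ, 1 ≤ s.re → s ≠ 1 → Λ s ≠ 0
  ne_zero_one : meromorphicOrderAt Λ 1 ≤ 0
  finite_order : ∃ A B : ℝ, ∀ s : ℂ, 1 / 2 ≤ s.re → 1 ≤ |s.im| →
    ‖Λ s‖ ≤ B * Real.exp (|s.im| ^ A)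

/-- The class `F_k(α)` of multiplicative functions `f : ℕ → ℂ` with `|f(n)| ≤ d_k(n)`, whose
`L`-functions `L(f, χ, s)` have the analytic continuation above for every Dirichlet character `χ`,
and satisfy the second moment estimate on the line `Re s = 1/2`, uniformly in `q`, `χ` and `T`. -/
structure ClassF (k : ℕ) (α : ℝ) (f : ArithmeticFunction ℂ) : Prop where
  multiplicative : f.IsMultiplicative
  divisor_bound : ∀ n : ℕ, ‖f n‖ ≤ (divisorK k n : ℝ)
  analytic : ∃ Λ : (q : ℕ) → DirichletCharacter ℂ q → ℂ → ℂ,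
    (∀ q : ℕ, 0 < q → ∀ χ : DirichletCharacter ℂ q, IsLContinuation f χ (Λ q χ)) ∧
    (∀ ε : ℝ, 0 < ε → ∃ C : ℝ, ∀ q : ℕ, 0 < q → ∀ χ : DirichletCharacter ℂ q, ∀ T : ℝ, 1 ≤ T →
      ∫ t in (-T)..T, ‖Λ q χ (1 / 2 + (t : ℂ) * Complex.I)‖ ^ 2
        ≤ C * (q : ℝ) ^ (ε ^ 2) * (1 + T) ^ (1 + α + ε ^ 2))

/-- `∑_{x ≤ m ≤ x + H} g(m) e(mθ)`. -/
noncomputable def shortExpSum (g : ArithmeticFunction ℂ) (x H θ : ℝ) : ℂ :=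
  ∑ m ∈ Finset.Icc ⌈x⌉₊ ⌊x + H⌋₊, g m * expE ((m : ℝ) * θ)

/-- `∑_{u ≤ m ≤ v} d_k(m)`, over positive integers `m`. -/
noncomputable def divisorSum (k : ℕ) (u v : ℝ) : ℝ :=
  ∑ m ∈ Finset.Icc ⌈u⌉₊ ⌊v⌋₊, (divisorK k m : ℝ)

/-!
Write `m = d n`, where `d` is composed of primes dividing `q` and `n` is coprime to `q`, and expand
`n ↦ e(d n a / q)` on the reduced residues in Dirichlet characters; by Parseval the coefficients
have `ℓ¹`-norm at most `√q`, and the sum over `d` costs only `q ^ κ`. This reduces the problem to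
sums of `g(n) χ(n)` against a smooth cutoff `W` of `u ↦ e(γ u)` to `[x, x + H]`. The cutoff takes
place on the scale `1 / |γ|`, so that the sharp and smooth sums differ only by the terms within
`1 / |γ| ≤ H ^ η` of the end points.

By Mellin inversion the smooth sum is an integral of `L(g, χ, s)` against the Mellin transform of
`W`. With `W` chosen of integral zero, that transform vanishes at `1` and cancels the possible pole,
so the contour moves to `Re s = 1/2`; a damping factor `exp (-δ cos (s - 5/4))`, doubly
exponentially small on the strip and hence stronger than any finite order of `L`, justifies the
shift and is removed in the limit `δ → 0`. On that line, Cauchy–Schwarz with the weight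
`T ^ 2 + t ^ 2`, `T ≍ |γ| X`, splits the integral into the second moment of `L(g, χ, ·)` and a
Plancherel integral of size `H`.

In part (b) the end terms are at most `(|γ|⁻¹ + 1) X ^ δ` for every `δ > 0`. If `H ≥ X ^ (1/3)`, the
saving `H ^ (-ε/2)` in `|γ|⁻¹ ≤ H ^ (η - ε/2)` absorbs `X ^ δ`; otherwise the whole is at most
`X ^ (1/2)`, which the first term dominates.
-/

theorem exists_pow_card_primeFactors_le_rpow {A δ : ℝ} (hA : 1 ≤ A) (hδ : 0 < δ) :
    ∃ C : ℝ, 0 < C ∧ ∀ n : ℕ, n ≠ 0 → A ^ n.primeFactors.card ≤ C * (n : ℝ) ^ δ := by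
  have hA0 : 0 < A := one_pos.trans_le hA
  set P : ℕ := ⌈A ^ δ⁻¹⌉₊
  have hlarge {p : ℕ} (hp : P ≤ p) : A ≤ (p : ℝ) ^ δ := by
    rw [← Real.rpow_inv_le_iff_of_pos hA0.le p.cast_nonneg hδ]
    exact (Nat.le_ceil _).trans (by exact_mod_cast hp)
  have hfactor {n p : ℕ} (hp : p ∈ n.primeFactors) :
      A ≤ (if p < P then A else 1) * (p : ℝ) ^ δ := by
    split_ifs with h
    · have : (1 : ℝ) ≤ p := by exact_mod_cast (Nat.prime_of_mem_primeFactors hp).one_le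
      exact le_mul_of_one_le_right hA0.le (Real.one_le_rpow this hδ.le)
    · rw [one_mul]; exact hlarge (not_lt.mp h)
  have hsmall (n : ℕ) : ∏ p ∈ n.primeFactors, (if p < P then A else 1) ≤ A ^ P := by
    rw [← Finset.prod_filter, Finset.prod_const]
    refine pow_le_pow_right₀ hA
      ((Finset.card_le_card fun p hp => ?_).trans_eq (Finset.card_range P))
    exact Finset.mem_range.mpr (Finset.mem_filter.mp hp).2
  refine ⟨A ^ P, by positivity, fun n hn => ?_⟩
  calc A ^ n.primeFactors.card
      ≤ ∏ p ∈ n.primeFactors, ((if p < P then A else 1) * (p : ℝ) ^ δ) :=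
        Finset.prod_const A ▸ Finset.prod_le_prod (fun _ _ => hA0.le) fun p hp => hfactor hp
    _ = (∏ p ∈ n.primeFactors, (if p < P then A else 1)) *
          (∏ p ∈ n.primeFactors, (p : ℝ)) ^ δ := by
        rw [Finset.prod_mul_distrib, Real.finsetProd_rpow _ _ fun p _ => p.cast_nonneg]
    _ ≤ A ^ P * (n : ℝ) ^ δ := by
        gcongr
        · exact hsmall n
        · rw [← Nat.cast_prod]
          exact_mod_cast Nat.le_of_dvd (Nat.pos_of_ne_zero hn) (Nat.prod_primeFactors_dvd n)

theorem natCast_add_one_le_mul_pow {c x : ℝ} (hc : 0 < c) (hx : 1 + c ≤ x) (v : ℕ) :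
    (v : ℝ) + 1 ≤ (1 + c⁻¹) * x ^ v := by
  calc (v : ℝ) + 1 ≤ (1 + c⁻¹) * (1 + v * c) := by
        have : (1 + c⁻¹) * (1 + v * c) = v + 1 + (c⁻¹ + v * c) := by field_simp; ring
        rw [this]
        exact le_add_of_nonneg_right (by positivity)
    _ ≤ (1 + c⁻¹) * (1 + c) ^ v := by
        gcongr
        exact one_add_mul_le_pow (by linarith) v
    _ ≤ (1 + c⁻¹) * x ^ v := by gcongr

theorem prod_primeFactors_rpow_pow_factorization {n : ℕ} (hn : n ≠ 0) (δ : ℝ) :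
    ∏ p ∈ n.primeFactors, ((p : ℝ) ^ δ) ^ n.factorization p = (n : ℝ) ^ δ := by
  conv_rhs => rw [← Nat.prod_factorization_pow_eq_self hn, Finsupp.prod, Nat.cast_prod]
  rw [← Real.finsetProd_rpow _ _ (fun i _ => by positivity)]
  refine Finset.prod_congr rfl fun p _ => ?_
  rw [Nat.cast_pow, Real.rpow_pow_comm p.cast_nonneg]

theorem exists_card_divisors_le_rpow {δ : ℝ} (hδ : 0 < δ) :
    ∃ C : ℝ, 0 < C ∧ ∀ n : ℕ, (n.divisors.card : ℝ) ≤ C * (n : ℝ) ^ δ := by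
  have hc : 0 < (2 : ℝ) ^ (δ / 2) - 1 :=
    sub_pos.mpr (Real.one_lt_rpow one_lt_two (half_pos hδ))
  set A : ℝ := 1 + ((2 : ℝ) ^ (δ / 2) - 1)⁻¹
  have hA : 1 ≤ A := le_add_of_nonneg_right (inv_nonneg.mpr hc.le)
  obtain ⟨C, hC, h⟩ := exists_pow_card_primeFactors_le_rpow hA (half_pos hδ)
  refine ⟨C, hC, fun n => ?_⟩
  rcases eq_or_ne n 0 with rfl | hn
  · simp only [Nat.divisors_zero, Finset.card_empty, Nat.cast_zero]
    positivity
  have hn0 : (0 : ℝ) < n := by exact_mod_cast Nat.pos_of_ne_zero hn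
  have hfactor : ∀ p ∈ n.primeFactors,
      (n.factorization p : ℝ) + 1 ≤ A * ((p : ℝ) ^ (δ / 2)) ^ n.factorization p := by
    refine fun p hp => natCast_add_one_le_mul_pow hc ?_ _
    rw [add_sub_cancel]
    have := (Nat.prime_of_mem_primeFactors hp).two_le
    gcongr
    exact_mod_cast this
  calc (n.divisors.card : ℝ) = ∏ p ∈ n.primeFactors, ((n.factorization p : ℝ) + 1) := by
        rw [Nat.card_divisors hn]; push_cast; rfl
    _ ≤ ∏ p ∈ n.primeFactors, A * ((p : ℝ) ^ (δ / 2)) ^ n.factorization p :=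
        Finset.prod_le_prod (fun _ _ => by positivity) hfactor
    _ = A ^ n.primeFactors.card * (n : ℝ) ^ (δ / 2) := by
        rw [Finset.prod_mul_distrib, Finset.prod_const, prod_primeFactors_rpow_pow_factorization hn]
    _ ≤ C * (n : ℝ) ^ (δ / 2) * (n : ℝ) ^ (δ / 2) := by gcongr; exact h n hn
    _ = C * (n : ℝ) ^ δ := by rw [mul_assoc, ← Real.rpow_add hn0, add_halves]

theorem divisorK_succ_apply (k n : ℕ) :
    divisorK (k + 1) n = ∑ d ∈ n.divisors, divisorK k d := by
  rw [divisorK, pow_succ, ← ArithmeticFunction.coe_mul_zeta_apply, ArithmeticFunction.natCoe_nat]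
  rfl

theorem exists_divisorK_le_rpow (k : ℕ) : ∀ {δ : ℝ}, 0 < δ →
    ∃ C : ℝ, 0 < C ∧ ∀ n : ℕ, (divisorK k n : ℝ) ≤ C * (n : ℝ) ^ δ := by
  induction k with
  | zero =>
    refine fun {δ} _ => ⟨1, one_pos, fun n => ?_⟩
    rw [divisorK, pow_zero, ArithmeticFunction.one_apply]
    split_ifs with h
    · simp [h]
    · simp only [Nat.cast_zero]; positivity
  | succ k ih =>
    intro δ hδ
    obtain ⟨C₁, hC₁, h₁⟩ := ih (half_pos hδ)
    obtain ⟨C₂, hC₂, h₂⟩ := exists_card_divisors_le_rpow (half_pos hδ)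
    refine ⟨C₂ * C₁, mul_pos hC₂ hC₁, fun n => ?_⟩
    rcases eq_or_ne n 0 with rfl | hn
    · simp only [ArithmeticFunction.map_zero, Nat.cast_zero]; positivity
    have hn0 : (0 : ℝ) < n := by exact_mod_cast Nat.pos_of_ne_zero hn
    calc (divisorK (k + 1) n : ℝ) = ∑ d ∈ n.divisors, (divisorK k d : ℝ) := by
          rw [divisorK_succ_apply, Nat.cast_sum]
      _ ≤ ∑ _d ∈ n.divisors, C₁ * (n : ℝ) ^ (δ / 2) := by
          refine Finset.sum_le_sum fun d hd => (h₁ d).trans ?_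
          gcongr
          exact Nat.divisor_le hd
      _ = n.divisors.card * (C₁ * (n : ℝ) ^ (δ / 2)) := by rw [Finset.sum_const, nsmul_eq_mul]
      _ ≤ (C₂ * (n : ℝ) ^ (δ / 2)) * (C₁ * (n : ℝ) ^ (δ / 2)) := by gcongr; exact h₂ n
      _ = C₂ * C₁ * ((n : ℝ) ^ (δ / 2) * (n : ℝ) ^ (δ / 2)) := by ring
      _ = C₂ * C₁ * (n : ℝ) ^ δ := by rw [← Real.rpow_add hn0, add_halves]

theorem exists_sum_factoredNumbers_rpow_le {β δ : ℝ} (hβ : 0 < β) (hδ : 0 < δ) :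
    ∃ C : ℝ, 0 < C ∧ ∀ q : ℕ, q ≠ 0 → ∀ D : Finset ℕ,
      (∀ d ∈ D, d ∈ Nat.factoredNumbers q.primeFactors) →
        ∑ d ∈ D, (d : ℝ) ^ (-β) ≤ C * (q : ℝ) ^ δ := by
  have hb : (2 : ℝ) ^ (-β) < 1 := Real.rpow_lt_one_of_one_lt_of_neg one_lt_two (neg_lt_zero.mpr hβ)
  set A : ℝ := (1 - (2 : ℝ) ^ (-β))⁻¹
  have hA : 1 ≤ A := (one_le_inv₀ (sub_pos.mpr hb)).mpr (sub_le_self _ (by positivity))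
  obtain ⟨C, hC, hCq⟩ := exists_pow_card_primeFactors_le_rpow hA hδ
  let f : ℕ →* ℝ :=
    { toFun := fun n => (n : ℝ) ^ (-β)
      map_one' := by simp only [Nat.cast_one, Real.one_rpow]
      map_mul' := fun a b => by rw [Nat.cast_mul, Real.mul_rpow a.cast_nonneg b.cast_nonneg] }
  have hf0 (n : ℕ) : 0 ≤ f n := Real.rpow_nonneg n.cast_nonneg _
  have hfp {p : ℕ} (hp : p.Prime) : f p ≤ (2 : ℝ) ^ (-β) :=
    Real.rpow_le_rpow_of_nonpos two_pos (by exact_mod_cast hp.two_le) (neg_nonpos.mpr hβ.le)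
  refine ⟨C, hC, fun q hq D hD => ?_⟩
  obtain ⟨-, hEuler⟩ := EulerProduct.summable_and_hasSum_factoredNumbers_prod_filter_prime_geometric
    (f := f) (fun {p} hp => by
      rw [Real.norm_of_nonneg (hf0 p)]; exact (hfp hp).trans_lt hb) q.primeFactors
  calc ∑ d ∈ D, (d : ℝ) ^ (-β) ≤ ∏ p ∈ q.primeFactors with p.Prime, (1 - f p)⁻¹ := by
        have := sum_le_hasSum (D.subtype (· ∈ Nat.factoredNumbers q.primeFactors))
          (fun i _ => hf0 i) hEuler
        rwa [Finset.sum_subtype_of_mem (fun d => f d) hD] at this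
    _ ≤ ∏ p ∈ q.primeFactors with p.Prime, A := by
        refine Finset.prod_le_prod (fun p hp => ?_) fun p hp => ?_
        all_goals have := hfp (Finset.mem_filter.mp hp).2
        · exact inv_nonneg.mpr (by linarith)
        · exact inv_anti₀ (by linarith) (by linarith)
    _ = A ^ q.primeFactors.card := by
        rw [Finset.prod_const,
          Finset.filter_true_of_mem fun p hp => Nat.prime_of_mem_primeFactors hp]
    _ ≤ C * (q : ℝ) ^ δ := hCq q hq

theorem sum_conj_dirichletCharacter_mul {q : ℕ} [NeZero q] (b b' : (ZMod q)ˣ) :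
    ∑ χ : DirichletCharacter ℂ q, (starRingEnd ℂ) (χ b) * χ b' =
      if b = b' then (q.totient : ℂ) else 0 := by
  have hconj (χ : DirichletCharacter ℂ q) :
      (starRingEnd ℂ) (χ b) = χ ((b : ZMod q)⁻¹) := by
    rw [ZMod.inv_coe_unit, ← Complex.inv_eq_conj (χ.unit_norm_eq_one b)]
    refine (eq_inv_of_mul_eq_one_left ?_).symm
    rw [← map_mul, Units.inv_mul, map_one]
  simp only [hconj, DirichletCharacter.sum_char_inv_mul_char_eq ℂ b.isUnit, Units.val_inj]

/-- The coefficient of `χ` in the expansion of a function `F` on the reduced residues modulo `q`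
in Dirichlet characters. -/
noncomputable def dirichletCoeff {q : ℕ} [NeZero q] (F : (ZMod q)ˣ → ℂ)
    (χ : DirichletCharacter ℂ q) : ℂ :=
  (q.totient : ℂ)⁻¹ * ∑ b, F b * (starRingEnd ℂ) (χ b)

section dirichletCoeff

variable {q : ℕ} [NeZero q] (F : (ZMod q)ˣ → ℂ)

theorem sum_dirichletCoeff_mul (b : (ZMod q)ˣ) : ∑ χ, dirichletCoeff F χ * χ b = F b := by
  have hφ : (q.totient : ℂ) ≠ 0 := by
    exact_mod_cast (Nat.totient_pos.mpr (NeZero.pos q)).ne'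
  calc ∑ χ, dirichletCoeff F χ * χ b
      = (q.totient : ℂ)⁻¹ * ∑ b', F b' *
          ∑ χ : DirichletCharacter ℂ q, (starRingEnd ℂ) (χ b') * χ b := by
        simp only [dirichletCoeff, mul_assoc, ← Finset.mul_sum, Finset.sum_mul]
        rw [Finset.sum_comm]
        simp only [Finset.mul_sum]
    _ = F b := by
        simp only [sum_conj_dirichletCharacter_mul, mul_ite, mul_zero, Finset.sum_ite_eq',
          Finset.mem_univ, if_true]
        field_simp

theorem sum_norm_sq_dirichletCoeff :
    ∑ χ, ‖dirichletCoeff F χ‖ ^ 2 = (q.totient : ℝ)⁻¹ * ∑ b, ‖F b‖ ^ 2 := by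
  apply Complex.ofReal_injective
  push_cast
  simp only [← Complex.mul_conj']
  have hconj (χ : DirichletCharacter ℂ q) : (starRingEnd ℂ) (dirichletCoeff F χ) =
      (q.totient : ℂ)⁻¹ * ∑ b, (starRingEnd ℂ) (F b) * χ b := by
    simp only [dirichletCoeff, map_mul, map_inv₀, map_natCast, map_sum, Complex.conj_conj]
  calc ∑ χ, dirichletCoeff F χ * (starRingEnd ℂ) (dirichletCoeff F χ)
      = (q.totient : ℂ)⁻¹ * ∑ b, (starRingEnd ℂ) (F b) * ∑ χ, dirichletCoeff F χ * χ b := by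
        simp only [hconj, Finset.mul_sum]
        rw [Finset.sum_comm]
        exact Finset.sum_congr rfl fun b _ => Finset.sum_congr rfl fun χ _ => by ring
    _ = (q.totient : ℂ)⁻¹ * ∑ b, F b * (starRingEnd ℂ) (F b) := by
        simp only [sum_dirichletCoeff_mul, mul_comm]

theorem sum_norm_dirichletCoeff_le (hF : ∀ b, ‖F b‖ ≤ 1) : ∑ χ, ‖dirichletCoeff F χ‖ ≤ √q := by
  have hφ : (0 : ℝ) < q.totient := by exact_mod_cast Nat.totient_pos.mpr (NeZero.pos q)
  have hParseval : ∑ χ, ‖dirichletCoeff F χ‖ ^ 2 ≤ 1 := by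
    rw [sum_norm_sq_dirichletCoeff, inv_mul_le_iff₀ hφ, mul_one]
    calc ∑ b, ‖F b‖ ^ 2 ≤ ∑ _b : (ZMod q)ˣ, (1 : ℝ) :=
          Finset.sum_le_sum fun b _ => pow_le_one₀ (norm_nonneg _) (hF b)
      _ = q.totient := by simp [ZMod.card_units_eq_totient]
  have hcard : ((Finset.univ : Finset (DirichletCharacter ℂ q)).card : ℝ) ≤ q := by
    rw [Finset.card_univ, ← Nat.card_eq_fintype_card,
      DirichletCharacter.card_eq_totient_of_hasEnoughRootsOfUnity]
    exact_mod_cast Nat.totient_le q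
  refine Real.le_sqrt_of_sq_le ?_
  calc (∑ χ, ‖dirichletCoeff F χ‖) ^ 2
      ≤ (Finset.univ : Finset (DirichletCharacter ℂ q)).card * ∑ χ, ‖dirichletCoeff F χ‖ ^ 2 :=
        sq_sum_le_card_mul_sum_sq
    _ ≤ q * 1 := by gcongr
    _ = q := mul_one _

end dirichletCoeff

theorem exists_mem_factoredNumbers_mul_coprime {q m : ℕ} (hq : q ≠ 0) (hm : m ≠ 0) :
    ∃ d n : ℕ, d ∈ Nat.factoredNumbers q.primeFactors ∧ n.Coprime q ∧ d * n = m := by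
  induction m using induction_on_primes with
  | zero => exact absurd rfl hm
  | one => exact ⟨1, 1, by simp [Nat.mem_factoredNumbers], q.coprime_one_left, rfl⟩
  | prime_mul p a hp ih =>
    obtain ⟨d, n, hd, hn, rfl⟩ := ih (right_ne_zero_of_mul hm)
    by_cases hpq : p ∣ q
    · refine ⟨p * d, n, Nat.mul_mem_factoredNumbers ?_ hd, hn, mul_assoc p d n⟩
      refine Nat.mem_factoredNumbers_of_primeFactors_subset hp.ne_zero ?_
      rw [hp.primeFactors, Finset.singleton_subset_iff]
      exact Nat.mem_primeFactors.mpr ⟨hp, hpq, hq⟩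
    · exact ⟨d, p * n, hd, (hp.coprime_iff_not_dvd.mpr hpq).mul_left hn, mul_left_comm d p n⟩

theorem coprime_of_mem_factoredNumbers {q d n : ℕ} (hd : d ∈ Nat.factoredNumbers q.primeFactors)
    (hn : n.Coprime q) : d.Coprime n := by
  refine Nat.coprime_of_dvd fun p hp hpd hpn => ?_
  have hpq := Nat.dvd_of_mem_primeFactors (Nat.mem_factoredNumbers'.mp hd p hp hpd)
  exact hp.one_lt.ne' (Nat.dvd_one.mp (hn ▸ Nat.dvd_gcd hpn hpq))

theorem eq_and_eq_of_factored_mul_coprime {q d d' n n' : ℕ}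
    (hd : d ∈ Nat.factoredNumbers q.primeFactors) (hd' : d' ∈ Nat.factoredNumbers q.primeFactors)
    (hn : n.Coprime q) (hn' : n'.Coprime q) (h : d * n = d' * n') : d = d' ∧ n = n' := by
  have hdd : d = d' := Nat.dvd_antisymm
    ((coprime_of_mem_factoredNumbers hd hn').dvd_of_dvd_mul_right (h ▸ dvd_mul_right d n))
    ((coprime_of_mem_factoredNumbers hd' hn).dvd_of_dvd_mul_right (h ▸ dvd_mul_right d' n'))
  subst hdd
  exact ⟨rfl, Nat.eq_of_mul_eq_mul_left (Nat.pos_of_ne_zero hd.1) h⟩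

theorem sum_Icc_eq_sum_factored_sum_coprime {M : Type*} [AddCommMonoid M] {q N : ℕ} (hq : q ≠ 0)
    (h : ℕ → M) (hN : ∀ m, N < m → h m = 0) :
    ∑ m ∈ Finset.Icc 1 N, h m =
      ∑ d ∈ Finset.Icc 1 N with d ∈ Nat.factoredNumbers q.primeFactors,
        ∑ n ∈ Finset.Icc 1 N with n.Coprime q, h (d * n) := by
  have hext : ∑ m ∈ Finset.Icc 1 N, h m = ∑ m ∈ Finset.Icc 1 (N * N), h m := by
    refine Finset.sum_subset (Finset.Icc_subset_Icc_right (Nat.le_mul_self N)) fun m hm hm' => ?_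
    simp only [Finset.mem_Icc, not_and, not_le] at hm hm'
    exact hN m (hm' hm.1)
  rw [hext, ← Finset.sum_product']
  symm
  refine Finset.sum_of_injOn (fun x : ℕ × ℕ => x.1 * x.2) ?_ ?_ ?_ fun _ _ => rfl
  all_goals simp only [Finset.coe_product, Finset.coe_filter, Finset.mem_Icc]
  · rintro ⟨d, n⟩ ⟨⟨-, hd⟩, -, hn⟩ ⟨d', n'⟩ ⟨⟨-, hd'⟩, -, hn'⟩ he
    exact Prod.ext_iff.mpr (eq_and_eq_of_factored_mul_coprime hd hd' hn hn' he)
  · rintro ⟨d, n⟩ ⟨⟨hd, -⟩, hn, -⟩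
    exact Finset.mem_coe.mpr
      (Finset.mem_Icc.mpr ⟨Nat.mul_pos hd.1 hn.1, Nat.mul_le_mul hd.2 hn.2⟩)
  · intro m hm hm'
    by_contra hne
    have hmN : m ≤ N := not_lt.mp fun hlt => hne (hN m hlt)
    obtain ⟨d, n, hd, hn, rfl⟩ := exists_mem_factoredNumbers_mul_coprime hq (by lia : m ≠ 0)
    have hd0 : 1 ≤ d := Nat.pos_of_ne_zero (left_ne_zero_of_mul (by lia : d * n ≠ 0))
    have hn0 : 1 ≤ n := Nat.pos_of_ne_zero (right_ne_zero_of_mul (by lia : d * n ≠ 0))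
    exact hm' ⟨(d, n), ⟨⟨⟨hd0, (Nat.le_mul_of_pos_right d hn0).trans hmN⟩, hd⟩,
      ⟨hn0, (Nat.le_mul_of_pos_left n hd0).trans hmN⟩, hn⟩, rfl⟩

open MeasureTheory in
theorem integral_exp_neg_smul_comp_exp_neg {E : Type*} [NormedAddCommGroup E] [NormedSpace ℝ E]
    (f : ℝ → E) :
    ∫ v, Real.exp (-v) • f (Real.exp (-v)) = ∫ u in Set.Ioi (0 : ℝ), f u := by
  have himage : (fun v => Real.exp (-v)) '' Set.univ = Set.Ioi 0 := by
    rw [Set.image_univ]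
    exact (neg_surjective.range_comp Real.exp).trans Real.range_exp
  have hderiv (v : ℝ) (_ : v ∈ Set.univ) :
      HasDerivWithinAt (fun v => Real.exp (-v)) (-Real.exp (-v)) Set.univ v := by
    simpa only [mul_neg, mul_one] using (hasDerivAt_neg v).exp.hasDerivWithinAt
  have hinj : Set.InjOn (fun v => Real.exp (-v)) Set.univ :=
    (Real.exp_injective.comp neg_injective).injOn
  rw [← himage, integral_image_eq_integral_abs_deriv_smul MeasurableSet.univ hderiv hinj]
  simp only [abs_neg, Real.abs_exp, setIntegral_univ]

/-- `W` is smooth and supported in the compact interval `[a, b]` of positive reals. -/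
structure IsMellinTest (W : ℝ → ℂ) (a b : ℝ) : Prop where
  smooth : ContDiff ℝ (⊤ : ℕ∞) W
  pos : 0 < a
  eq_zero : ∀ u, u ∉ Set.Icc a b → W u = 0

namespace IsMellinTest

open MeasureTheory Set Filter Topology
open scoped FourierTransform SchwartzMap

variable {W : ℝ → ℂ} {a b : ℝ}

theorem comp_mul_left (hW : IsMellinTest W a b) {d : ℝ} (hd : 0 < d) :
    IsMellinTest (fun u => W (d * u)) (a / d) (b / d) where
  smooth := hW.smooth.comp (contDiff_const.mul contDiff_id)
  pos := div_pos hW.pos hd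
  eq_zero _ hu := hW.eq_zero _ fun h => hu
    ⟨(div_le_iff₀' hd).mpr h.1, (le_div_iff₀' hd).mpr h.2⟩

protected theorem deriv (hW : IsMellinTest W a b) : IsMellinTest (deriv W) a b where
  smooth := (contDiff_infty_iff_deriv.mp hW.smooth).2
  pos := hW.pos
  eq_zero u hu := by
    have : W =ᶠ[𝓝 u] fun _ => 0 := by
      filter_upwards [isClosed_Icc.isOpen_compl.mem_nhds hu] with v hv using hW.eq_zero v hv
    rw [this.deriv_eq, deriv_const]

theorem id_smul_deriv (hW : IsMellinTest W a b) : IsMellinTest (fun u => u • deriv W u) a b where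
  smooth := contDiff_id.smul hW.deriv.smooth
  pos := hW.pos
  eq_zero u hu := by rw [hW.deriv.eq_zero u hu, smul_zero]

theorem const_smul (hW : IsMellinTest W a b) (c : ℂ) : IsMellinTest (fun u => c • W u) a b where
  smooth := hW.smooth.const_smul c
  pos := hW.pos
  eq_zero u hu := by rw [hW.eq_zero u hu, smul_zero]

theorem hasDerivAt (hW : IsMellinTest W a b) (u : ℝ) : HasDerivAt W (deriv W u) u :=
  (hW.smooth.differentiable (by norm_num) u).hasDerivAt

theorem eventuallyEq_zero_atTop (hW : IsMellinTest W a b) : W =ᶠ[atTop] 0 := by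
  filter_upwards [eventually_gt_atTop b] with u hu
  exact hW.eq_zero u fun h => hu.not_ge h.2

theorem eventuallyEq_zero_nhdsGT (hW : IsMellinTest W a b) : W =ᶠ[𝓝[>] 0] 0 := by
  filter_upwards [nhdsWithin_le_nhds (eventually_lt_nhds hW.pos)] with u hu
  exact hW.eq_zero u fun h => hu.not_ge h.1

theorem isBigO_atTop (hW : IsMellinTest W a b) (f : ℝ → ℝ) : W =O[atTop] f :=
  hW.eventuallyEq_zero_atTop.trans_isBigO (Asymptotics.isBigO_zero _ _)

theorem isBigO_nhdsGT (hW : IsMellinTest W a b) (f : ℝ → ℝ) : W =O[𝓝[>] 0] f :=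
  hW.eventuallyEq_zero_nhdsGT.trans_isBigO (Asymptotics.isBigO_zero _ _)

theorem mellinConvergent (hW : IsMellinTest W a b) (s : ℂ) : MellinConvergent W s :=
  mellinConvergent_of_isBigO_rpow (hW.smooth.continuous.locallyIntegrable.locallyIntegrableOn _)
    (hW.isBigO_atTop _) (lt_add_one s.re) (hW.isBigO_nhdsGT _) (sub_one_lt s.re)

theorem differentiable_mellin (hW : IsMellinTest W a b) : Differentiable ℂ (mellin W) := fun s =>
  mellin_differentiableAt_of_isBigO_rpow
    (hW.smooth.continuous.locallyIntegrable.locallyIntegrableOn _)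
    (hW.isBigO_atTop _) (lt_add_one s.re) (hW.isBigO_nhdsGT _) (sub_one_lt s.re)

theorem exists_norm_mellin_le (hW : IsMellinTest W a b) (σ₁ σ₂ : ℝ) :
    ∃ M : ℝ, ∀ s : ℂ, σ₁ ≤ s.re → s.re ≤ σ₂ → ‖mellin W s‖ ≤ M := by
  have h₁ := (hW.mellinConvergent (σ₁ : ℂ)).norm
  have h₂ := (hW.mellinConvergent (σ₂ : ℂ)).norm
  refine ⟨_, fun s hs₁ hs₂ => (norm_integral_le_integral_norm _).trans
    (setIntegral_mono_on (hW.mellinConvergent s).norm (h₁.add h₂) measurableSet_Ioi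
      fun t (ht : 0 < t) => ?_)⟩
  simp only [Pi.add_apply, norm_smul, Complex.norm_cpow_eq_rpow_re_of_pos ht, Complex.sub_re,
    Complex.one_re, Complex.ofReal_re, ← add_mul]
  gcongr
  rcases le_total t 1 with h | h
  · exact le_add_of_le_of_nonneg (Real.rpow_le_rpow_of_exponent_ge ht h (sub_le_sub_right hs₁ 1))
      (Real.rpow_nonneg ht.le _)
  · exact le_add_of_nonneg_of_le (Real.rpow_nonneg ht.le _)
      (Real.rpow_le_rpow_of_exponent_le h (sub_le_sub_right hs₂ 1))

theorem mellin_id_smul_deriv (hW : IsMellinTest W a b) (s : ℂ) :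
    mellin (fun u => u • deriv W u) s = -s * mellin W s := by
  have hcpow (u : ℝ) (hu : u ∈ Ioi (0 : ℝ)) :
      HasDerivAt (fun u : ℝ => (u : ℂ) ^ s) (s * (u : ℂ) ^ (s - 1)) u :=
    ((hasDerivAt_id (u : ℂ)).cpow_const (Or.inl hu)).comp_ofReal.congr_deriv (mul_one _)
  have hleft : EqOn (fun u : ℝ => (u : ℂ) ^ (s - 1) • u • deriv W u)
      (fun u : ℝ => (u : ℂ) ^ s * deriv W u) (Ioi 0) := fun u (hu : 0 < u) => by
    have hu0 : (u : ℂ) ≠ 0 := Complex.ofReal_ne_zero.mpr hu.ne'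
    simp only [smul_eq_mul, Complex.real_smul, Complex.cpow_sub _ _ hu0, Complex.cpow_one]
    field_simp
  have hright : EqOn (fun u : ℝ => s * (u : ℂ) ^ (s - 1) * W u)
      (fun u : ℝ => s * ((u : ℂ) ^ (s - 1) • W u)) (Ioi 0) := fun u _ => mul_assoc _ _ _
  have hzero {l : Filter ℝ} (h : W =ᶠ[l] 0) :
      Tendsto ((fun u : ℝ => (u : ℂ) ^ s) * W) l (𝓝 0) := by
    refine tendsto_const_nhds.congr' (h.mono fun u hu => ?_)
    rw [Pi.mul_apply, hu, Pi.zero_apply, mul_zero]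
  have hparts := integral_Ioi_mul_deriv_eq_deriv_mul hcpow (fun u _ => hW.hasDerivAt u)
    ((hW.id_smul_deriv.mellinConvergent s).congr_fun hleft measurableSet_Ioi)
    (IntegrableOn.congr_fun ((hW.mellinConvergent s).const_mul s) hright.symm measurableSet_Ioi)
    (hzero hW.eventuallyEq_zero_nhdsGT) (hzero hW.eventuallyEq_zero_atTop)
  rw [mellin, mellin, setIntegral_congr_fun measurableSet_Ioi hleft, hparts,
    setIntegral_congr_fun measurableSet_Ioi hright, integral_const_mul]
  ring

theorem mellin_deriv_one (hW : IsMellinTest W a b) : mellin (deriv W) 1 = 0 := by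
  have h := hW.mellin_id_smul_deriv 0
  rw [neg_zero, zero_mul] at h
  rw [← h, ← zero_add (1 : ℂ), ← mellin_cpow_smul]
  simp only [Complex.cpow_one, Complex.coe_smul]

theorem hasCompactSupport_exp (hW : IsMellinTest W a b) (σ : ℝ) :
    HasCompactSupport fun v : ℝ => Real.exp (-σ * v) • W (Real.exp (-v)) := by
  refine HasCompactSupport.intro (K := Icc (-Real.log b) (-Real.log a)) isCompact_Icc fun v hv => ?_
  rw [hW.eq_zero _ fun h => hv ?_, smul_zero]
  exact ⟨neg_le.mp ((Real.le_log_iff_exp_le (hW.pos.trans_le (h.1.trans h.2))).mpr h.2),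
    le_neg.mp ((Real.log_le_iff_le_exp hW.pos).mpr h.1)⟩

theorem contDiff_exp (hW : IsMellinTest W a b) (σ : ℝ) :
    ContDiff ℝ (⊤ : ℕ∞) fun v : ℝ => Real.exp (-σ * v) • W (Real.exp (-v)) :=
  (Real.contDiff_exp.comp (contDiff_const.mul contDiff_id)).smul
    (hW.smooth.comp (Real.contDiff_exp.comp contDiff_neg))

/-- The Schwartz function `v ↦ exp (-σ v) W (exp (-v))`, whose Fourier transform is the Mellin
transform of `W` on the line `Re s = σ`. -/
noncomputable def toSchwartz (hW : IsMellinTest W a b) (σ : ℝ) : 𝓢(ℝ, ℂ) :=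
  (hW.hasCompactSupport_exp σ).toSchwartzMap (hW.contDiff_exp σ)

theorem mellin_eq_fourier_toSchwartz (hW : IsMellinTest W a b) (σ t : ℝ) :
    mellin W (σ + t * Complex.I) = 𝓕 (hW.toSchwartz σ) (t / (2 * Real.pi)) := by
  have h : (hW.toSchwartz σ : ℝ → ℂ) = fun v => Real.exp (-σ * v) • W (Real.exp (-v)) := rfl
  rw [mellin_eq_fourier, SchwartzMap.fourier_coe, h]
  simp

theorem verticalIntegrable_mellin (hW : IsMellinTest W a b) (σ : ℝ) :
    Integrable fun t : ℝ => mellin W (σ + t * Complex.I) := by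
  simp_rw [hW.mellin_eq_fourier_toSchwartz]
  exact (𝓕 (hW.toSchwartz σ)).integrable.comp_div (by positivity)

theorem mellinInv_mellin (hW : IsMellinTest W a b) (σ : ℝ) {u : ℝ} (hu : 0 < u) :
    mellinInv σ (mellin W) u = W u :=
  mellinInv_mellin_eq σ W hu (hW.mellinConvergent σ) (hW.verticalIntegrable_mellin σ)
    hW.smooth.continuous.continuousAt

theorem memLp_two_mellin (hW : IsMellinTest W a b) (σ : ℝ) :
    MemLp (fun t : ℝ => mellin W (σ + t * Complex.I)) 2 := by
  rw [memLp_two_iff_integrable_sq_norm (hW.verticalIntegrable_mellin σ).aestronglyMeasurable]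
  simp_rw [hW.mellin_eq_fourier_toSchwartz]
  exact Integrable.comp_div (g := fun ξ => ‖𝓕 (hW.toSchwartz σ) ξ‖ ^ 2)
    (((𝓕 (hW.toSchwartz σ)).memLp 2).integrable_norm_pow two_ne_zero) (by positivity)

theorem integral_norm_sq_toSchwartz (hW : IsMellinTest W a b) (σ : ℝ) :
    ∫ v, ‖hW.toSchwartz σ v‖ ^ 2 = ∫ u in Ioi (0 : ℝ), u ^ (2 * σ - 1) * ‖W u‖ ^ 2 := by
  rw [← integral_exp_neg_smul_comp_exp_neg]
  refine integral_congr_ae (ae_of_all _ fun v => ?_)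
  have hexp : Real.exp (-σ * v) ^ 2 = Real.exp (-v) * Real.exp (-v) ^ (2 * σ - 1) := by
    rw [← Real.exp_mul, ← Real.exp_add, ← Real.exp_nat_mul]
    push_cast
    ring_nf
  simp only [toSchwartz, HasCompactSupport.toSchwartzMap_toFun, norm_smul, Real.norm_eq_abs,
    Real.abs_exp, mul_pow, hexp, smul_eq_mul, mul_assoc]

theorem integral_norm_sq_mellin (hW : IsMellinTest W a b) (σ : ℝ) :
    ∫ t : ℝ, ‖mellin W (σ + t * Complex.I)‖ ^ 2 =
      2 * Real.pi * ∫ u in Ioi (0 : ℝ), u ^ (2 * σ - 1) * ‖W u‖ ^ 2 := by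
  simp_rw [hW.mellin_eq_fourier_toSchwartz]
  rw [Measure.integral_comp_div (fun ξ => ‖𝓕 (hW.toSchwartz σ) ξ‖ ^ 2),
    SchwartzMap.integral_norm_sq_fourier, integral_norm_sq_toSchwartz, smul_eq_mul,
    abs_of_pos (by positivity)]

theorem integral_norm_sq_le (hW : IsMellinTest W a b) (hab : a ≤ b) {B : ℝ}
    (hB : ∀ u, ‖W u‖ ≤ B) : ∫ u in Ioi (0 : ℝ), ‖W u‖ ^ 2 ≤ B ^ 2 * (b - a) := by
  have hsub : Icc a b ⊆ Ioi 0 := fun u hu => hW.pos.trans_le hu.1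
  rw [setIntegral_eq_of_subset_of_forall_sdiff_eq_zero measurableSet_Ioi hsub fun u hu => by
    rw [hW.eq_zero u hu.2, norm_zero, sq, mul_zero]]
  calc ∫ u in Icc a b, ‖W u‖ ^ 2 ≤ ∫ _ in Icc a b, B ^ 2 := by
        refine setIntegral_mono_on ?_ (by simp) measurableSet_Icc fun u _ => by gcongr; exact hB u
        exact (hW.smooth.continuous.norm.pow 2).continuousOn.integrableOn_Icc
    _ = B ^ 2 * (b - a) := by
        rw [setIntegral_const, Real.volume_real_Icc_of_le hab, smul_eq_mul, mul_comm]

theorem integral_norm_sq_mellin_half_le (hW : IsMellinTest W a b) (hab : a ≤ b) {B : ℝ}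
    (hB : ∀ u, ‖W u‖ ≤ B) :
    ∫ t : ℝ, ‖mellin W (1 / 2 + t * Complex.I)‖ ^ 2 ≤ 2 * Real.pi * (B ^ 2 * (b - a)) := by
  have h := hW.integral_norm_sq_mellin (1 / 2)
  norm_num at h
  norm_num [h]
  gcongr
  exact hW.integral_norm_sq_le hab hB

theorem sq_mul_norm_sq_mellin_half_le (hW : IsMellinTest W a b) (t : ℝ) :
    t ^ 2 * ‖mellin W (1 / 2 + t * Complex.I)‖ ^ 2 ≤
      ‖mellin (fun u => u • deriv W u) (1 / 2 + t * Complex.I)‖ ^ 2 := by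
  rw [hW.mellin_id_smul_deriv, norm_mul, norm_neg, mul_pow, ← sq_abs t]
  gcongr
  simpa using Complex.abs_im_le_norm (1 / 2 + t * Complex.I)

theorem memLp_two_mellin_half (hW : IsMellinTest W a b) :
    MemLp (fun t : ℝ => mellin W (1 / 2 + t * Complex.I)) 2 := by
  simpa using hW.memLp_two_mellin (1 / 2)

theorem integrable_sq_mul_norm_sq_mellin_half (hW : IsMellinTest W a b) :
    Integrable fun t : ℝ => t ^ 2 * ‖mellin W (1 / 2 + t * Complex.I)‖ ^ 2 := by
  refine hW.id_smul_deriv.memLp_two_mellin_half.norm.integrable_sq.mono' ?_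
    (ae_of_all _ fun t => ?_)
  · exact (continuous_pow 2).aestronglyMeasurable.mul
      (hW.memLp_two_mellin_half.aestronglyMeasurable.norm.pow 2)
  · rw [Real.norm_of_nonneg (by positivity)]
    exact hW.sq_mul_norm_sq_mellin_half_le t

theorem integral_sq_mul_norm_sq_mellin_half_le (hW : IsMellinTest W a b) (hab : a ≤ b) {B : ℝ}
    (hB : ∀ u, ‖u • deriv W u‖ ≤ B) :
    ∫ t : ℝ, t ^ 2 * ‖mellin W (1 / 2 + t * Complex.I)‖ ^ 2 ≤
      2 * Real.pi * (B ^ 2 * (b - a)) :=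
  (integral_mono hW.integrable_sq_mul_norm_sq_mellin_half
    hW.id_smul_deriv.memLp_two_mellin_half.norm.integrable_sq
    hW.sq_mul_norm_sq_mellin_half_le).trans
      (hW.id_smul_deriv.integral_norm_sq_mellin_half_le hab hB)

end IsMellinTest

section ContourShift

open MeasureTheory Set Filter Topology

variable {E : Type*} [NormedAddCommGroup E] [NormedSpace ℂ E] {F : ℂ → E} {σ₁ σ₂ : ℝ}

theorem tendsto_integral_horizontal_zero (hσ : σ₁ ≤ σ₂)
    (hdecay : Tendsto F (comap (fun s => |s.im|) atTop ⊓ 𝓟 (Complex.re ⁻¹' Icc σ₁ σ₂)) (𝓝 0))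
    {l : Filter ℝ} (hl : Tendsto abs l atTop) :
    Tendsto (fun τ : ℝ => ∫ x in σ₁..σ₂, F (x + τ * Complex.I)) l (𝓝 0) := by
  rw [NormedAddGroup.tendsto_nhds_zero] at hdecay ⊢
  intro ε hε
  have hη : 0 < ε / (|σ₂ - σ₁| + 1) := by positivity
  have hev := hdecay _ hη
  rw [eventually_inf_principal, eventually_comap] at hev
  filter_upwards [hl.eventually hev] with τ hτ
  have hbound : ∀ x ∈ uIoc σ₁ σ₂, ‖F (x + τ * Complex.I)‖ ≤ ε / (|σ₂ - σ₁| + 1) := by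
    intro x hx
    rw [uIoc_of_le hσ] at hx
    exact (hτ _ (by simp) ⟨by simpa using hx.1.le, by simpa using hx.2⟩).le
  calc _ ≤ ε / (|σ₂ - σ₁| + 1) * |σ₂ - σ₁| :=
        intervalIntegral.norm_integral_le_of_norm_le_const hbound
    _ < ε / (|σ₂ - σ₁| + 1) * (|σ₂ - σ₁| + 1) := by gcongr; exact lt_add_one _
    _ = ε := div_mul_cancel₀ _ (by positivity)

theorem integral_vertical_eq_of_tendsto_zero [CompleteSpace E] (hσ : σ₁ ≤ σ₂) {S : Set ℂ}
    (hS : S.Countable) (hcont : ContinuousOn F (Complex.re ⁻¹' Icc σ₁ σ₂))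
    (hdiff : ∀ s : ℂ, s.re ∈ Ioo σ₁ σ₂ → s ∉ S → DifferentiableAt ℂ F s)
    (hdecay : Tendsto F (comap (fun s => |s.im|) atTop ⊓ 𝓟 (Complex.re ⁻¹' Icc σ₁ σ₂)) (𝓝 0))
    (h₁ : Integrable fun t : ℝ => F (σ₁ + t * Complex.I))
    (h₂ : Integrable fun t : ℝ => F (σ₂ + t * Complex.I)) :
    ∫ t : ℝ, F (σ₁ + t * Complex.I) = ∫ t : ℝ, F (σ₂ + t * Complex.I) := by
  have hrect (T : ℝ) :
      Complex.I •
          ((∫ y in (-T)..T, F (σ₁ + y * Complex.I)) - ∫ y in (-T)..T, F (σ₂ + y * Complex.I))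
        = (∫ x in σ₁..σ₂, F (x + (-T : ℝ) * Complex.I)) - ∫ x in σ₁..σ₂, F (x + T * Complex.I) := by
    have h := Complex.integral_boundary_rect_eq_zero_of_differentiable_on_off_countable F
      ⟨σ₁, -T⟩ ⟨σ₂, T⟩ S hS (hcont.mono fun s hs => uIcc_of_le hσ ▸ hs.1) fun s hs => ?_
    · rw [smul_sub, eq_comm, ← sub_eq_zero, ← h]
      simp only
      abel
    · have hre := hs.1.1
      rw [mem_preimage, min_eq_left hσ, max_eq_right hσ] at hre
      exact hdiff s hre hs.2
  have hhor := ((tendsto_integral_horizontal_zero hσ hdecay tendsto_abs_atBot_atTop).comp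
    tendsto_neg_atTop_atBot).sub
      (tendsto_integral_horizontal_zero hσ hdecay tendsto_abs_atTop_atTop)
  have hver := ((intervalIntegral_tendsto_integral h₁ tendsto_neg_atTop_atBot tendsto_id).sub
    (intervalIntegral_tendsto_integral h₂ tendsto_neg_atTop_atBot tendsto_id)).const_smul Complex.I
  have hlim := tendsto_nhds_unique (hver.congr hrect) hhor
  rwa [sub_zero, smul_eq_zero_iff_right Complex.I_ne_zero, sub_eq_zero] at hlim

end ContourShift

section StripDamping

open MeasureTheory Set Filter Topology

/-- An entire function tending to `1` as `δ → 0`, and decaying doubly exponentially along the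
vertical lines of the strip `1 / 2 ≤ Re s ≤ 2` for `δ > 0`: this beats every function of finite
order. -/
noncomputable def stripDamping (δ : ℝ) (s : ℂ) : ℂ := Complex.exp (-δ * Complex.cos (s - 5 / 4))

variable {δ : ℝ} {s : ℂ}

theorem differentiable_stripDamping (δ : ℝ) : Differentiable ℂ (stripDamping δ) := by
  unfold stripDamping; fun_prop

theorem norm_stripDamping (δ : ℝ) (s : ℂ) :
    ‖stripDamping δ s‖ = Real.exp (-(δ * (Real.cos (s.re - 5 / 4) * Real.cosh s.im))) := by
  have hs : s - 5 / 4 = ((s.re - 5 / 4 : ℝ) : ℂ) + (s.im : ℝ) * Complex.I := by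
    apply Complex.ext <;> simp
  have hcos : (Complex.cos (s - 5 / 4)).re = Real.cos (s.re - 5 / 4) * Real.cosh s.im := by
    rw [hs, Complex.cos_add_mul_I, ← Complex.ofReal_cos, ← Complex.ofReal_sin,
      ← Complex.ofReal_cosh, ← Complex.ofReal_sinh]
    simp only [Complex.sub_re, Complex.mul_re, Complex.ofReal_re, Complex.ofReal_im, Complex.mul_im,
      Complex.I_re, Complex.I_im, mul_zero, zero_mul, sub_zero, add_zero, mul_one]
  rw [stripDamping, Complex.norm_exp, neg_mul, Complex.neg_re, Complex.re_ofReal_mul, hcos]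

theorem norm_stripDamping_le (hδ : 0 ≤ δ) (hs : s.re ∈ Icc (1 / 2) 2) :
    ‖stripDamping δ s‖ ≤ Real.exp (-(δ / 2) * Real.cosh s.im) := by
  have hcos : 1 / 2 ≤ Real.cos (s.re - 5 / 4) := by
    have := Real.one_sub_sq_div_two_le_cos (x := s.re - 5 / 4)
    nlinarith [hs.1, hs.2]
  rw [norm_stripDamping, neg_mul,
    show δ / 2 * Real.cosh s.im = δ * (1 / 2 * Real.cosh s.im) by ring]
  gcongr

theorem norm_stripDamping_le_one (hδ : 0 ≤ δ) (hs : s.re ∈ Icc (1 / 2) 2) :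
    ‖stripDamping δ s‖ ≤ 1 := by
  refine (norm_stripDamping_le hδ hs).trans (Real.exp_le_one_iff.mpr ?_)
  exact mul_nonpos_of_nonpos_of_nonneg (by linarith) (Real.cosh_pos _).le

theorem tendsto_integral_mul_stripDamping {G : ℝ → ℂ} (hG : Integrable G) {σ : ℝ}
    (hσ : σ ∈ Icc (1 / 2) 2) :
    Tendsto (fun δ => ∫ t : ℝ, G t * stripDamping δ (σ + t * Complex.I)) (𝓝[>] 0)
      (𝓝 (∫ t, G t)) := by
  refine tendsto_integral_filter_of_dominated_convergence (fun t => ‖G t‖) ?_ ?_ hG.norm ?_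
  · refine Eventually.of_forall fun δ => hG.aestronglyMeasurable.mul ?_
    exact ((differentiable_stripDamping δ).continuous.comp (by fun_prop)).aestronglyMeasurable
  · filter_upwards [self_mem_nhdsWithin] with δ hδ
    refine ae_of_all _ fun t => (norm_mul_le _ _).trans ?_
    exact mul_le_of_le_one_right (norm_nonneg _)
      (norm_stripDamping_le_one (le_of_lt hδ) (by simpa using hσ))
  · refine ae_of_all _ fun t => ?_
    have hcont : Continuous fun δ => G t * stripDamping δ (σ + t * Complex.I) := by
      unfold stripDamping; fun_prop
    have h0 := (hcont.tendsto 0).mono_left (nhdsWithin_le_nhds (s := Ioi 0))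
    simpa [stripDamping] using h0

end StripDamping

section FiniteOrder

open Set Filter Topology

theorem tendsto_exp_rpow_sub_mul_cosh (A : ℝ) {c : ℝ} (hc : 0 < c) :
    Tendsto (fun T : ℝ => Real.exp (T ^ A - c * Real.cosh T)) atTop (𝓝 0) := by
  refine Real.tendsto_exp_atBot.comp ?_
  have hexp : Tendsto (fun T : ℝ => -(c / 4) * Real.exp T) atTop atBot :=
    Real.tendsto_exp_atTop.const_mul_atTop_of_neg (by linarith)
  refine tendsto_atBot_mono' _ ?_ hexp
  filter_upwards [(isLittleO_rpow_exp_atTop A).bound (by positivity : 0 < c / 4),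
    eventually_ge_atTop 0] with T hlittle hT
  rw [Real.norm_of_nonneg (by positivity), Real.norm_of_nonneg (by positivity)] at hlittle
  have hcosh : Real.exp T / 2 ≤ Real.cosh T := by
    rw [Real.cosh_eq]
    linarith [Real.exp_pos (-T)]
  nlinarith

theorem one_le_meromorphicOrderAt {h : ℂ → ℂ} {z : ℂ} (hh : AnalyticAt ℂ h z) (hz : h z = 0) :
    1 ≤ meromorphicOrderAt h z := by
  have hpos : 0 < meromorphicOrderAt h z := by
    rw [← tendsto_zero_iff_meromorphicOrderAt_pos hh.meromorphicAt, ← hz]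
    exact hh.continuousAt.tendsto.mono_left nhdsWithin_le_nhds
  generalize meromorphicOrderAt h z = n at hpos ⊢
  cases n with
  | top => exact le_top
  | coe n => exact_mod_cast Int.add_one_le_of_lt (WithTop.coe_pos.mp hpos)

end FiniteOrder

namespace IsLContinuation

open MeasureTheory Set Filter Topology

variable {f : ArithmeticFunction ℂ} {q : ℕ} {χ : DirichletCharacter ℂ q} {Λ h : ℂ → ℂ}

theorem continuous_vertical (hΛ : IsLContinuation f χ Λ) {σ : ℝ} (hσ : 1 / 2 ≤ σ) (hσ1 : σ ≠ 1) :
    Continuous fun t : ℝ => Λ (σ + t * Complex.I) := by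
  refine hΛ.continuous_boundary.comp_continuous (by fun_prop) fun t => ⟨by simpa using hσ, ?_⟩
  intro h
  exact hσ1 (by simpa using congrArg Complex.re (mem_singleton_iff.mp h))

theorem neg_one_le_meromorphicOrderAt (hΛ : IsLContinuation f χ Λ) :
    -1 ≤ meromorphicOrderAt Λ 1 := by
  by_cases h : χ = 1
  · exact hΛ.order_one_principal h
  · exact le_trans (by decide) (hΛ.order_one_nonprincipal h)

theorem exists_tendsto_mul (hΛ : IsLContinuation f χ Λ) (hh : Differentiable ℂ h)
    (h1 : h 1 = 0) : ∃ c, Tendsto (fun s => Λ s * h s) (𝓝[≠] 1) (𝓝 c) := by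
  have han : AnalyticAt ℂ h 1 := hh.analyticAt 1
  refine tendsto_nhds_of_meromorphicOrderAt_nonneg
    (f := fun s => Λ s * h s) (hΛ.meromorphic_one.mul han.meromorphicAt) ?_
  rw [fun_meromorphicOrderAt_mul hΛ.meromorphic_one han.meromorphicAt]
  calc (0 : WithTop ℤ) = -1 + 1 := by decide
    _ ≤ _ := add_le_add hΛ.neg_one_le_meromorphicOrderAt (one_le_meromorphicOrderAt han h1)

theorem exists_extension_mul (hΛ : IsLContinuation f χ Λ) (hh : Differentiable ℂ h)
    (h1 : h 1 = 0) : ∃ F : ℂ → ℂ, (∀ s ≠ 1, F s = Λ s * h s) ∧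
      ContinuousOn F {s | 1 / 2 ≤ s.re} ∧ DifferentiableOn ℂ F ({s | 1 / 2 < s.re} \ {1}) := by
  obtain ⟨c, hc⟩ := hΛ.exists_tendsto_mul hh h1
  have heq : ∀ s ≠ 1, Function.update (fun s => Λ s * h s) 1 c s = Λ s * h s := fun s hs =>
    Function.update_of_ne hs _ _
  refine ⟨_, heq, continuousOn_update_iff.mpr ⟨?_, fun _ => ?_⟩, ?_⟩
  · exact hΛ.continuous_boundary.mul hh.continuous.continuousOn
  · exact hc.mono_left (nhdsWithin_mono 1 fun s hs => hs.2)
  · exact (hΛ.holomorphic.mul hh.differentiableOn).congr fun s hs => heq s hs.2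

theorem tendsto_mul_zero (hΛ : IsLContinuation f χ Λ) {E c : ℝ} (hc : 0 < c)
    (hh : ∀ s : ℂ, s.re ∈ Icc (1 / 2) 2 → ‖h s‖ ≤ E * Real.exp (-c * Real.cosh s.im)) :
    Tendsto (fun s => Λ s * h s)
      (comap (fun s => |s.im|) atTop ⊓ 𝓟 (Complex.re ⁻¹' Icc (1 / 2) 2)) (𝓝 0) := by
  obtain ⟨A, B, hAB⟩ := hΛ.finite_order
  have hlim := (tendsto_exp_rpow_sub_mul_cosh A hc).const_mul (B * E)
  rw [mul_zero] at hlim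
  refine squeeze_zero_norm' ?_ ((hlim.comp tendsto_comap).mono_left inf_le_left)
  rw [eventually_inf_principal]
  filter_upwards [tendsto_comap.eventually (eventually_ge_atTop (1 : ℝ))] with s him hre
  have hΛs := hAB s hre.1 him
  calc ‖Λ s * h s‖ ≤ B * Real.exp (|s.im| ^ A) * (E * Real.exp (-c * Real.cosh s.im)) :=
        (norm_mul _ _).trans_le
          (mul_le_mul hΛs (hh s hre) (norm_nonneg _) ((norm_nonneg _).trans hΛs))
    _ = B * E * (Real.exp (|s.im| ^ A) * Real.exp (-c * Real.cosh s.im)) := by ring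
    _ = _ := by rw [← Real.exp_add, ← Real.cosh_abs, neg_mul, ← sub_eq_add_neg]; rfl

theorem integral_half_eq_integral_two_of_exp_decay (hΛ : IsLContinuation f χ Λ)
    (hh : Differentiable ℂ h) (h1 : h 1 = 0) {E c : ℝ} (hc : 0 < c)
    (hdecay : ∀ s : ℂ, s.re ∈ Icc (1 / 2) 2 → ‖h s‖ ≤ E * Real.exp (-c * Real.cosh s.im))
    (hl : Integrable fun t : ℝ => Λ (1 / 2 + t * Complex.I) * h (1 / 2 + t * Complex.I))
    (hr : Integrable fun t : ℝ => Λ (2 + t * Complex.I) * h (2 + t * Complex.I)) :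
    ∫ t : ℝ, Λ (1 / 2 + t * Complex.I) * h (1 / 2 + t * Complex.I) =
      ∫ t : ℝ, Λ (2 + t * Complex.I) * h (2 + t * Complex.I) := by
  obtain ⟨F, hF, hcont, hdiff⟩ := hΛ.exists_extension_mul hh h1
  have hopen : IsOpen ({s : ℂ | 1 / 2 < s.re} \ {1}) :=
    (isOpen_lt continuous_const Complex.continuous_re).sdiff isClosed_singleton
  have hdecayF : Tendsto F
      (comap (fun s => |s.im|) atTop ⊓ 𝓟 (Complex.re ⁻¹' Icc (1 / 2) 2)) (𝓝 0) := by
    refine (hΛ.tendsto_mul_zero hc hdecay).congr' (Eventually.filter_mono inf_le_left ?_)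
    filter_upwards [tendsto_comap.eventually (eventually_ge_atTop (1 : ℝ))] with s him
    refine (hF s ?_).symm
    rintro rfl
    norm_num at him
  have hFl (t : ℝ) : Λ (1 / 2 + t * Complex.I) * h (1 / 2 + t * Complex.I)
      = F ((1 / 2 : ℝ) + t * Complex.I) := by
    rw [hF _ fun h => by simpa using congrArg Complex.re h]
    push_cast
    rfl
  have hFr (t : ℝ) : Λ (2 + t * Complex.I) * h (2 + t * Complex.I)
      = F ((2 : ℝ) + t * Complex.I) := by
    rw [hF _ fun h => by simpa using congrArg Complex.re h]
    push_cast
    rfl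
  simp_rw [hFl] at hl ⊢
  simp_rw [hFr] at hr ⊢
  exact integral_vertical_eq_of_tendsto_zero (by norm_num) (countable_singleton 1)
    (hcont.mono fun s hs => hs.1)
    (fun s hs hs1 => hdiff.differentiableAt (hopen.mem_nhds ⟨hs.1, hs1⟩)) hdecayF hl hr

theorem integral_half_eq_integral_two (hΛ : IsLContinuation f χ Λ) (hh : Differentiable ℂ h)
    (h1 : h 1 = 0) {M : ℝ} (hM : ∀ s : ℂ, s.re ∈ Icc (1 / 2) 2 → ‖h s‖ ≤ M)
    (hl : Integrable fun t : ℝ => Λ (1 / 2 + t * Complex.I) * h (1 / 2 + t * Complex.I))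
    (hr : Integrable fun t : ℝ => Λ (2 + t * Complex.I) * h (2 + t * Complex.I)) :
    ∫ t : ℝ, Λ (1 / 2 + t * Complex.I) * h (1 / 2 + t * Complex.I) =
      ∫ t : ℝ, Λ (2 + t * Complex.I) * h (2 + t * Complex.I) := by
  have hdamp {σ : ℝ} (hσ : σ ∈ Icc (1 / 2) 2) {δ : ℝ} (hδ : 0 ≤ δ)
      (hint : Integrable fun t : ℝ => Λ (σ + t * Complex.I) * h (σ + t * Complex.I)) :
      Integrable fun t : ℝ =>
        Λ (σ + t * Complex.I) * h (σ + t * Complex.I) * stripDamping δ (σ + t * Complex.I) :=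
    hint.mul_bdd (c := 1)
      ((differentiable_stripDamping δ).continuous.comp (by fun_prop)).aestronglyMeasurable
      (ae_of_all _ fun t => norm_stripDamping_le_one hδ (by simpa using hσ))
  have hhalf := tendsto_integral_mul_stripDamping hl (σ := 1 / 2) (by norm_num)
  have htwo := tendsto_integral_mul_stripDamping hr (σ := 2) (by norm_num)
  refine tendsto_nhds_unique hhalf (htwo.congr' ?_)
  filter_upwards [self_mem_nhdsWithin] with δ hδ
  have hδ0 : (0 : ℝ) < δ := hδ
  have hl' := hdamp (σ := 1 / 2) (by norm_num) hδ0.le (by simpa using hl)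
  have hr' := hdamp (σ := 2) (by norm_num) hδ0.le (by simpa using hr)
  have hshift := hΛ.integral_half_eq_integral_two_of_exp_decay (E := M)
    (hh.mul (differentiable_stripDamping δ)) (by simp [h1]) (half_pos hδ0)
    (fun s hs => (norm_mul _ _).trans_le (mul_le_mul (hM s hs) (norm_stripDamping_le hδ0.le hs)
      (norm_nonneg _) ((norm_nonneg _).trans (hM s hs))))
    (by simpa [mul_assoc] using hl') (by simpa [mul_assoc] using hr')
  simpa [mul_assoc] using hshift.symm

end IsLContinuation

section MellinPerron

open MeasureTheory Set Filter Topology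

variable {W : ℝ → ℂ} {a b : ℝ}

theorem continuous_LSeries_term_vertical (A : ℕ → ℂ) (σ : ℝ) (n : ℕ) :
    Continuous fun t : ℝ => LSeries.term A (σ + t * Complex.I) n := by
  rcases eq_or_ne n 0 with rfl | hn
  · simpa only [LSeries.term_zero] using continuous_const
  · simp_rw [LSeries.term_of_ne_zero hn, div_eq_mul_inv, ← Complex.cpow_neg]
    refine continuous_const.mul (Continuous.const_cpow (by fun_prop) (Or.inl ?_))
    exact_mod_cast hn

theorem norm_LSeries_term_vertical (A : ℕ → ℂ) (σ t : ℝ) (n : ℕ) :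
    ‖LSeries.term A (σ + t * Complex.I) n‖ = ‖LSeries.term A σ n‖ := by
  simp [LSeries.norm_term_eq]

theorem norm_LSeries_vertical_le {A : ℕ → ℂ} {σ : ℝ} (hA : LSeriesSummable A σ) (t : ℝ) :
    ‖LSeries A (σ + t * Complex.I)‖ ≤ ∑' n, ‖LSeries.term A σ n‖ :=
  tsum_of_norm_bounded hA.norm.hasSum fun n => (norm_LSeries_term_vertical A σ t n).le

namespace IsMellinTest

theorem integral_LSeries_term_mul_mellin (hW : IsMellinTest W a b) (A : ℕ → ℂ) (σ : ℝ) (n : ℕ) :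
    ∫ t : ℝ, LSeries.term A (σ + t * Complex.I) n * mellin W (σ + t * Complex.I)
      = 2 * Real.pi * (A n * W n) := by
  rcases eq_or_ne n 0 with rfl | hn
  · simp [hW.eq_zero 0 fun h => hW.pos.not_ge h.1]
  · have hinv := hW.mellinInv_mellin σ (u := (n : ℝ)) (by positivity)
    have hpi : (Real.pi : ℂ) ≠ 0 := by exact_mod_cast Real.pi_ne_zero
    simp_rw [LSeries.term_of_ne_zero hn, div_eq_mul_inv, ← Complex.cpow_neg, mul_assoc,
      integral_const_mul]
    rw [← hinv, mellinInv]
    simp only [smul_eq_mul, Complex.real_smul, Complex.ofReal_natCast]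
    push_cast
    rw [mul_left_comm (A n), ← mul_assoc (Real.pi : ℂ), ← mul_assoc 2, ← mul_assoc 2,
      mul_one_div_cancel (mul_ne_zero two_ne_zero hpi), one_mul]

theorem hasSum_mul (hW : IsMellinTest W a b) {A : ℕ → ℂ} {σ : ℝ} (hA : LSeriesSummable A σ) :
    HasSum (fun n : ℕ => A n * W n) ((2 * Real.pi : ℂ)⁻¹ *
      ∫ t : ℝ, LSeries A (σ + t * Complex.I) * mellin W (σ + t * Complex.I)) := by
  have hint (n : ℕ) : Integrable fun t : ℝ =>
      LSeries.term A (σ + t * Complex.I) n * mellin W (σ + t * Complex.I) :=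
    (hW.verticalIntegrable_mellin σ).bdd_mul
      (continuous_LSeries_term_vertical A σ n).aestronglyMeasurable
      (ae_of_all _ fun t => (norm_LSeries_term_vertical A σ t n).le)
  have h := hasSum_integral_of_summable_integral_norm hint (by
    simp_rw [norm_mul, norm_LSeries_term_vertical, integral_const_mul]
    exact hA.norm.mul_right _)
  simp_rw [tsum_mul_right, hW.integral_LSeries_term_mul_mellin] at h
  have hpi : (2 * Real.pi : ℂ) ≠ 0 := by exact_mod_cast Real.two_pi_pos.ne'
  simpa only [inv_mul_cancel_left₀ hpi, LSeries] using h.mul_left (2 * Real.pi : ℂ)⁻¹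

end IsMellinTest

namespace IsLContinuation

variable {f : ArithmeticFunction ℂ} {q : ℕ} {χ : DirichletCharacter ℂ q} {Λ : ℂ → ℂ}

theorem hasSum_mul_mellin_half (hΛ : IsLContinuation f χ Λ)
    (hsum : LSeriesSummable (fun n : ℕ => f n * χ n) 2) (hW : IsMellinTest W a b)
    (hW1 : mellin W 1 = 0)
    (hint : Integrable fun t : ℝ => Λ (1 / 2 + t * Complex.I) * mellin W (1 / 2 + t * Complex.I)) :
    HasSum (fun n : ℕ => f n * χ n * W n) ((2 * Real.pi : ℂ)⁻¹ *
      ∫ t : ℝ, Λ (1 / 2 + t * Complex.I) * mellin W (1 / 2 + t * Complex.I)) := by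
  have hΛ2 (t : ℝ) : Λ (2 + t * Complex.I) = LSeries (fun n : ℕ => f n * χ n) (2 + t * Complex.I) :=
    hΛ.eq_LSeries _ (by simp)
  have hbound (t : ℝ) : ‖Λ (2 + t * Complex.I)‖ ≤ _ :=
    hΛ2 t ▸ norm_LSeries_vertical_le (σ := 2) (by simpa using hsum) t
  have hint2 : Integrable fun t : ℝ => Λ (2 + t * Complex.I) * mellin W (2 + t * Complex.I) :=
    (hW.verticalIntegrable_mellin 2).bdd_mul
      (hΛ.continuous_vertical (σ := 2) (by norm_num) (by norm_num)).aestronglyMeasurable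
      (ae_of_all _ hbound)
  obtain ⟨M, hM⟩ := hW.exists_norm_mellin_le (1 / 2) 2
  rw [hΛ.integral_half_eq_integral_two hW.differentiable_mellin hW1
    (fun s hs => hM s hs.1 hs.2) hint hint2]
  simp_rw [hΛ2]
  exact hW.hasSum_mul (σ := 2) (by simpa using hsum)

end IsLContinuation

end MellinPerron

section WeightedCauchySchwarz

open MeasureTheory

variable {Ω : Type*} [MeasurableSpace Ω] {μ : Measure Ω} {p r w : Ω → ℝ}

theorem memLp_two_div_sqrt (hp : AEMeasurable p μ) (hw : AEMeasurable w μ)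
    (hw0 : ∀ x, 0 ≤ w x) (hpw : Integrable (fun x => p x ^ 2 / w x) μ) :
    MemLp (fun x => p x / √(w x)) 2 μ := by
  refine (memLp_two_iff_integrable_sq (hp.div hw.sqrt).aestronglyMeasurable).mpr ?_
  simpa only [Pi.div_apply, div_pow, Real.sq_sqrt (hw0 _)] using hpw

theorem memLp_two_sqrt_mul (hr : AEMeasurable r μ) (hw : AEMeasurable w μ)
    (hw0 : ∀ x, 0 ≤ w x) (hwr : Integrable (fun x => w x * r x ^ 2) μ) :
    MemLp (fun x => √(w x) * r x) 2 μ := by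
  refine (memLp_two_iff_integrable_sq (hw.sqrt.mul hr).aestronglyMeasurable).mpr ?_
  simpa only [Pi.mul_apply, mul_pow, Real.sq_sqrt (hw0 _)] using hwr

theorem integrable_mul_of_weight (hp : AEMeasurable p μ) (hr : AEMeasurable r μ)
    (hw : AEMeasurable w μ) (hw0 : ∀ x, 0 < w x) (hpw : Integrable (fun x => p x ^ 2 / w x) μ)
    (hwr : Integrable (fun x => w x * r x ^ 2) μ) : Integrable (fun x => p x * r x) μ := by
  refine ((memLp_two_div_sqrt hp hw (fun x => (hw0 x).le) hpw).integrable_mul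
    (memLp_two_sqrt_mul hr hw (fun x => (hw0 x).le) hwr)).congr (ae_of_all _ fun x => ?_)
  have := Real.sqrt_ne_zero'.mpr (hw0 x)
  simp only [Pi.mul_apply]
  field_simp

theorem integral_mul_le_sqrt_mul_sqrt_of_weight (hp : AEMeasurable p μ) (hr : AEMeasurable r μ)
    (hw : AEMeasurable w μ) (hp0 : ∀ x, 0 ≤ p x) (hr0 : ∀ x, 0 ≤ r x) (hw0 : ∀ x, 0 < w x)
    (hpw : Integrable (fun x => p x ^ 2 / w x) μ) (hwr : Integrable (fun x => w x * r x ^ 2) μ) :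
    ∫ x, p x * r x ∂μ ≤ √(∫ x, p x ^ 2 / w x ∂μ) * √(∫ x, w x * r x ^ 2 ∂μ) := by
  have hw0' (x : Ω) : 0 ≤ w x := (hw0 x).le
  have h := integral_mul_le_Lp_mul_Lq_of_nonneg (μ := μ) Real.HolderConjugate.two_two
    (ae_of_all _ fun x => div_nonneg (hp0 x) (Real.sqrt_nonneg (w x)))
    (ae_of_all _ fun x => mul_nonneg (Real.sqrt_nonneg (w x)) (hr0 x))
    (by simpa using memLp_two_div_sqrt hp hw hw0' hpw)
    (by simpa using memLp_two_sqrt_mul hr hw hw0' hwr)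
  simp_rw [Real.rpow_two, div_pow, mul_pow, Real.sq_sqrt (hw0' _), ← Real.sqrt_eq_rpow] at h
  refine (integral_congr_ae (ae_of_all _ fun x => ?_)).trans_le h
  have := Real.sqrt_ne_zero'.mpr (hw0 x)
  field_simp

end WeightedCauchySchwarz

section QuadraticWeight

open MeasureTheory Set

theorem lintegral_Ioi_rpow_of_lt {a c : ℝ} (ha : a < -1) (hc : 0 < c) :
    ∫⁻ t in Ioi c, ENNReal.ofReal (t ^ a) = ENNReal.ofReal (-c ^ (a + 1) / (a + 1)) := by
  rw [← integral_Ioi_rpow_of_lt ha hc, ofReal_integral_eq_lintegral_ofReal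
    (integrableOn_Ioi_rpow_of_lt ha hc)]
  exact (ae_restrict_iff' measurableSet_Ioi).mpr
    (ae_of_all _ fun t ht => Real.rpow_nonneg (hc.trans ht).le a)

-- `1 / (T² + t²) ≤ max(T, |t|)⁻²`, and the latter is the integral of `2 s⁻³` over `s > T, |t|`.
theorem ofReal_one_div_sq_add_sq_le {T : ℝ} (hT : 0 < T) (t : ℝ) :
    ENNReal.ofReal (1 / (T ^ 2 + t ^ 2)) ≤
      ∫⁻ s in Ioi T, 2 * ENNReal.ofReal (s ^ (-3 : ℝ)) * {s | |t| ≤ s}.indicator 1 s := by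
  have hmax : 0 < max T |t| := lt_max_of_lt_left hT
  calc ENNReal.ofReal (1 / (T ^ 2 + t ^ 2)) ≤ ENNReal.ofReal ((max T |t| ^ 2)⁻¹) := by
        refine ENNReal.ofReal_le_ofReal ?_
        rw [one_div]
        gcongr
        rcases max_cases T |t| with h | h <;> rw [h.1] <;> nlinarith [sq_abs t]
    _ = ∫⁻ s in Ioi (max T |t|), 2 * ENNReal.ofReal (s ^ (-3 : ℝ)) := by
        rw [lintegral_const_mul _ (by fun_prop), lintegral_Ioi_rpow_of_lt (by norm_num) hmax,
          ← ENNReal.ofReal_ofNat 2, ← ENNReal.ofReal_mul zero_le_two]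
        congr 1
        norm_num [Real.rpow_neg hmax.le, mul_div_cancel₀]
    _ = ∫⁻ s in Ioi (max T |t|), 2 * ENNReal.ofReal (s ^ (-3 : ℝ)) *
          {s | |t| ≤ s}.indicator 1 s := by
        refine setLIntegral_congr_fun measurableSet_Ioi fun s (hs : max T |t| < s) => ?_
        simp [((le_max_right T |t|).trans_lt hs).le]
    _ ≤ _ := lintegral_mono_set (Ioi_subset_Ioi (le_max_left _ _))

theorem lintegral_ofReal_div_sq_add_sq_le {m : ℝ → ℝ} (hm : AEMeasurable m) (hm0 : ∀ t, 0 ≤ m t)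
    {T : ℝ} (hT : 0 < T) :
    ∫⁻ t, ENNReal.ofReal (m t / (T ^ 2 + t ^ 2)) ≤
      ∫⁻ s in Ioi T, 2 * ENNReal.ofReal (s ^ (-3 : ℝ)) *
        ∫⁻ t in Icc (-s) s, ENNReal.ofReal (m t) := by
  have hmeas : Measurable fun z : ℝ × ℝ => {s | |z.1| ≤ s}.indicator (1 : ℝ → ENNReal) z.2 :=
    measurable_const.indicator (s := {z : ℝ × ℝ | |z.1| ≤ z.2})
      (measurableSet_le (by fun_prop) (by fun_prop))
  calc ∫⁻ t, ENNReal.ofReal (m t / (T ^ 2 + t ^ 2))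
      ≤ ∫⁻ t, ∫⁻ s in Ioi T, ENNReal.ofReal (m t) *
          (2 * ENNReal.ofReal (s ^ (-3 : ℝ)) * {s | |t| ≤ s}.indicator 1 s) := by
        refine lintegral_mono fun t => ?_
        rw [lintegral_const_mul' _ _ ENNReal.ofReal_ne_top, div_eq_mul_one_div,
          ENNReal.ofReal_mul (hm0 t)]
        gcongr
        exact ofReal_one_div_sq_add_sq_le hT t
    _ = ∫⁻ s in Ioi T, ∫⁻ t, ENNReal.ofReal (m t) *
          (2 * ENNReal.ofReal (s ^ (-3 : ℝ)) * {s | |t| ≤ s}.indicator 1 s) := by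
        refine lintegral_lintegral_swap (hm.ennreal_ofReal.comp_fst.mul ?_)
        exact (Measurable.mul (by fun_prop) hmeas).aemeasurable
    _ = _ := by
        refine lintegral_congr fun s => ?_
        rw [← lintegral_const_mul' _ _ (by finiteness), ← lintegral_indicator measurableSet_Icc]
        refine lintegral_congr fun t => ?_
        by_cases ht : |t| ≤ s
        · simp [ht, abs_le.mp ht, mul_comm]
        · simp [ht, mt abs_le.mpr ht]

theorem lintegral_div_sq_add_sq_le {β M : ℝ} (hβ0 : 0 ≤ β) (hβ : β < 2) (hM : 0 ≤ M) {m : ℝ → ℝ}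
    (hm : LocallyIntegrable m) (hm0 : ∀ t, 0 ≤ m t)
    (hmom : ∀ T : ℝ, 1 ≤ T → ∫ t in (-T)..T, m t ≤ M * (1 + T) ^ β) {T : ℝ} (hT : 1 ≤ T) :
    ∫⁻ t, ENNReal.ofReal (m t / (T ^ 2 + t ^ 2)) ≤
      ENNReal.ofReal (2 ^ (β + 1) / (2 - β) * M * T ^ (β - 2)) := by
  have hT0 : 0 < T := zero_lt_one.trans_le hT
  have hblock {s : ℝ} (hs : 1 ≤ s) :
      ∫⁻ t in Icc (-s) s, ENNReal.ofReal (m t) ≤ ENNReal.ofReal (M * 2 ^ β * s ^ β) := by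
    rw [← ofReal_integral_eq_lintegral_ofReal (hm.integrableOn_isCompact isCompact_Icc)
      (ae_of_all _ hm0), integral_Icc_eq_integral_Ioc, ← intervalIntegral.integral_of_le
      (by linarith), mul_assoc, ← Real.mul_rpow zero_le_two (by linarith)]
    refine ENNReal.ofReal_le_ofReal ((hmom s hs).trans ?_)
    gcongr
    linarith
  calc _ ≤ ∫⁻ s in Ioi T, 2 * ENNReal.ofReal (s ^ (-3 : ℝ)) *
        ∫⁻ t in Icc (-s) s, ENNReal.ofReal (m t) :=
        lintegral_ofReal_div_sq_add_sq_le hm.aestronglyMeasurable.aemeasurable hm0 hT0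
    _ ≤ ∫⁻ s in Ioi T, ENNReal.ofReal (M * 2 ^ (β + 1)) * ENNReal.ofReal (s ^ (β - 3)) := by
        refine setLIntegral_mono (by fun_prop) fun s (hs : T < s) => ?_
        have hs0 : 0 < s := hT0.trans hs
        refine (mul_le_mul_right (hblock (hT.trans hs.le)) _).trans_eq ?_
        rw [← ENNReal.ofReal_ofNat 2, ← ENNReal.ofReal_mul zero_le_two,
          ← ENNReal.ofReal_mul (by positivity), ← ENNReal.ofReal_mul (by positivity),
          Real.rpow_add_one two_ne_zero, sub_eq_add_neg β, Real.rpow_add hs0]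
        ring_nf
    _ = ENNReal.ofReal (2 ^ (β + 1) / (2 - β) * M * T ^ (β - 2)) := by
        rw [lintegral_const_mul _ (by fun_prop), lintegral_Ioi_rpow_of_lt (by linarith) hT0,
          ← ENNReal.ofReal_mul (by positivity), show β - 3 + 1 = -(2 - β) by ring, neg_div_neg_eq,
          neg_sub]
        ring_nf

end QuadraticWeight

section SmoothWeight

open Filter Set Topology

theorem norm_iteratedDeriv_const_le {E : Type*} [NormedAddCommGroup E] [NormedSpace ℝ E]
    (i : ℕ) (c : E) (v : ℝ) : ‖iteratedDeriv i (fun _ : ℝ => c) v‖ ≤ ‖c‖ := by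
  rw [iteratedDeriv_const]
  split_ifs
  · exact le_rfl
  · exact norm_zero.trans_le (norm_nonneg c)

theorem exists_norm_iteratedDeriv_le_of_eq_const {E : Type*} [NormedAddCommGroup E]
    [NormedSpace ℝ E] {f : ℝ → E} {n : ℕ} (hf : ContDiff ℝ n f) {a b : ℝ} {c₁ c₂ : E}
    (h₁ : ∀ v < a, f v = c₁) (h₂ : ∀ v, b < v → f v = c₂) :
    ∃ B : ℝ, ∀ i ≤ n, ∀ v, ‖iteratedDeriv i f v‖ ≤ B := by
  have hbound (i : ℕ) (hi : i ≤ n) : ∃ B : ℝ, ∀ v, ‖iteratedDeriv i f v‖ ≤ B := by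
    obtain ⟨M, hM⟩ := (isCompact_Icc (a := a) (b := b)).exists_bound_of_continuousOn
      (hf.continuous_iteratedDeriv i (by exact_mod_cast hi)).continuousOn
    refine ⟨max M (max ‖c₁‖ ‖c₂‖), fun v => ?_⟩
    rcases lt_or_ge v a with hva | hva
    · rw [EventuallyEq.iteratedDeriv_eq i ((eventually_lt_nhds hva).mono h₁)]
      exact (norm_iteratedDeriv_const_le i c₁ v).trans (by simp)
    rcases lt_or_ge b v with hvb | hvb
    · rw [EventuallyEq.iteratedDeriv_eq i ((eventually_gt_nhds hvb).mono h₂)]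
      exact (norm_iteratedDeriv_const_le i c₂ v).trans (by simp)
    · exact (hM v ⟨hva, hvb⟩).trans (le_max_left _ _)
  choose! B hB using hbound
  obtain ⟨B', hB'⟩ := ((Finset.range (n + 1)).image B).exists_le
  exact ⟨B', fun i hi v => (hB i hi v).trans
    (hB' _ (Finset.mem_image_of_mem B (Finset.mem_range.mpr (by lia))))⟩

theorem norm_iteratedDeriv_smul_le {E : Type*} [NormedAddCommGroup E] [NormedSpace ℝ E]
    {f : ℝ → ℝ} {g : ℝ → E} {n : ℕ} (hf : ContDiff ℝ n f) (hg : ContDiff ℝ n g) {A B v : ℝ}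
    (hA : ∀ i ≤ n, ‖iteratedDeriv i f v‖ ≤ A) (hB : ∀ i ≤ n, ‖iteratedDeriv i g v‖ ≤ B)
    {m : ℕ} (hm : m ≤ n) :
    ‖iteratedDeriv m (fun u => f u • g u) v‖ ≤ 2 ^ n * (A * B) := by
  have hA0 : 0 ≤ A := (norm_nonneg _).trans (hA 0 n.zero_le)
  have hB0 : 0 ≤ B := (norm_nonneg _).trans (hB 0 n.zero_le)
  calc ‖iteratedDeriv m (fun u => f u • g u) v‖
      ≤ ∑ i ∈ Finset.range (m + 1), (m.choose i : ℝ) * (A * B) := by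
        rw [← norm_iteratedFDeriv_eq_norm_iteratedDeriv]
        refine (norm_iteratedFDeriv_smul_le hf hg v (by exact_mod_cast hm)).trans
          (Finset.sum_le_sum fun i hi => ?_)
        have him : i ≤ m := Nat.lt_succ_iff.mp (Finset.mem_range.mp hi)
        rw [norm_iteratedFDeriv_eq_norm_iteratedDeriv, norm_iteratedFDeriv_eq_norm_iteratedDeriv,
          mul_assoc]
        gcongr
        · exact hA i (him.trans hm)
        · exact hB (m - i) ((Nat.sub_le _ _).trans hm)
    _ = 2 ^ m * (A * B) := by
        rw [← Finset.sum_mul]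
        congr 1
        exact_mod_cast Nat.sum_range_choose m
    _ ≤ 2 ^ n * (A * B) := by
        gcongr
        exact one_le_two

theorem exists_smooth_window (n : ℕ) : ∃ B : ℝ, ∀ p r : ℝ, ∃ P : ℝ → ℝ,
    ContDiff ℝ (⊤ : ℕ∞) P ∧ (∀ v ∈ Icc p r, P =ᶠ[𝓝 v] fun _ => 1) ∧
      (∀ v ∉ Icc (p - 1) (r + 1), P v = 0) ∧ ∀ i ≤ n, ∀ v, ‖iteratedDeriv i P v‖ ≤ B := by
  set S : ℝ → ℝ := fun v => Real.smoothTransition (2 * v)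
  have hS : ContDiff ℝ (⊤ : ℕ∞) S := Real.smoothTransition.contDiff.comp (by fun_prop)
  have hS0 (v : ℝ) (hv : v < 0) : S v = 0 :=
    Real.smoothTransition.zero_of_nonpos (by linarith)
  have hS1 (v : ℝ) (hv : 1 / 2 < v) : S v = 1 :=
    Real.smoothTransition.one_of_one_le (by linarith)
  obtain ⟨B, hB⟩ := exists_norm_iteratedDeriv_le_of_eq_const (n := n)
    (contDiff_infty.mp hS n) hS0 hS1
  refine ⟨2 ^ n * (B * B), fun p r => ⟨fun v => S (v + (1 - p)) • S (r + 1 - v),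
    (hS.comp (by fun_prop)).smul (hS.comp (by fun_prop)), fun v hv => ?_, fun v hv => ?_,
    fun i hi v => ?_⟩⟩
  · filter_upwards [eventually_gt_nhds (by linarith [hv.1] : p - 1 / 2 < v),
      eventually_lt_nhds (by linarith [hv.2] : v < r + 1 / 2)] with u hpu hur
    rw [hS1 _ (by linarith), hS1 _ (by linarith), one_smul]
  · rcases not_and_or.mp hv with h | h
    · exact smul_eq_zero_of_left (hS0 _ (by linarith [not_le.mp h])) _
    · exact smul_eq_zero_of_right _ (hS0 _ (by linarith [not_le.mp h]))
  · refine norm_iteratedDeriv_smul_le (n := n) ?_ ?_ (fun j hj => ?_) (fun j hj => ?_) hi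
    · exact contDiff_infty.mp (hS.comp (by fun_prop)) n
    · exact contDiff_infty.mp (hS.comp (by fun_prop)) n
    · rw [iteratedDeriv_comp_add_const]
      exact hB j hj _
    · rw [iteratedDeriv_comp_const_sub, norm_smul, norm_pow, norm_neg, norm_one, one_pow, one_mul]
      exact hB j hj _

theorem norm_expE (θ : ℝ) : ‖expE θ‖ = 1 := by
  rw [← Complex.norm_exp_ofReal_mul_I (2 * Real.pi * θ), expE]
  push_cast
  ring_nf

theorem expE_add (θ φ : ℝ) : expE (θ + φ) = expE θ * expE φ := by
  rw [expE, expE, expE, ← Complex.exp_add, Complex.ofReal_add, mul_add]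

theorem contDiff_expE : ContDiff ℝ (⊤ : ℕ∞) expE :=
  (contDiff_const.mul Complex.ofRealCLM.contDiff).cexp

theorem hasDerivAt_expE (θ : ℝ) : HasDerivAt expE (2 * Real.pi * Complex.I * expE θ) θ := by
  have h := (Complex.ofRealCLM.hasDerivAt (x := θ)).const_mul (2 * (Real.pi : ℂ) * Complex.I)
  refine h.cexp.congr_deriv ?_
  rw [Complex.ofRealCLM_apply, Complex.ofRealCLM_apply, Complex.ofReal_one, mul_one, mul_comm, expE]

theorem iteratedDeriv_expE_mul (γ : ℝ) (n : ℕ) :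
    iteratedDeriv n (fun u => expE (γ * u)) =
      fun u => (2 * Real.pi * Complex.I * γ) ^ n * expE (γ * u) := by
  induction n with
  | zero => simp
  | succ n ih =>
    ext u
    rw [iteratedDeriv_succ, ih]
    have h := (hasDerivAt_expE (γ * u)).scomp u ((hasDerivAt_id u).const_mul γ)
    refine (h.const_mul ((2 * Real.pi * Complex.I * γ) ^ n)).deriv.trans ?_
    simp only [Complex.real_smul, mul_one]
    ring

/-- `W` agrees with the frequency `u ↦ e(γ u)` on `[x, y]`, is cut off smoothly within distance
`1 / |γ|` of that interval with norm bounds of the natural size, and has integral zero (the Mellin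
transform at `1`), so that it is not affected by a pole of an `L`-function at `1`. -/
structure IsFrequencyWeight (W : ℝ → ℂ) (γ x y B : ℝ) : Prop where
  isMellinTest : IsMellinTest W (x - 1 / |γ|) (y + 1 / |γ|)
  eq_expE : ∀ u ∈ Icc x y, W u = expE (γ * u)
  norm_le : ∀ u, ‖W u‖ ≤ B
  norm_deriv_le : ∀ u, ‖deriv W u‖ ≤ B * |γ|
  mellin_one : mellin W 1 = 0

namespace IsFrequencyWeight

theorem comp_mul_left {W : ℝ → ℂ} {γ x y B : ℝ} (hW : IsFrequencyWeight W γ x y B) {c : ℝ}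
    (hc : 0 < c) : IsFrequencyWeight (fun u => W (c * u)) (c * γ) (x / c) (y / c) B where
  isMellinTest := by
    have h := hW.isMellinTest.comp_mul_left hc
    rwa [sub_div, add_div, div_div, mul_comm |γ|, ← abs_of_pos hc, ← abs_mul, abs_of_pos hc] at h
  eq_expE u hu := by
    rw [hW.eq_expE (c * u) ⟨(div_le_iff₀' hc).mp hu.1, (le_div_iff₀' hc).mp hu.2⟩]
    ring_nf
  norm_le u := hW.norm_le (c * u)
  norm_deriv_le u := by
    rw [deriv_comp_mul_left, norm_smul, Real.norm_of_nonneg hc.le, abs_mul, abs_of_pos hc,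
      mul_left_comm]
    gcongr
    exact hW.norm_deriv_le (c * u)
  mellin_one := by rw [mellin_comp_mul_left W 1 hc, hW.mellin_one, smul_zero]

end IsFrequencyWeight

theorem exists_isFrequencyWeight_of_abs_eq_one : ∃ B : ℝ, ∀ ω x y : ℝ, |ω| = 1 → 1 < x →
    ∃ W, IsFrequencyWeight W ω x y B := by
  obtain ⟨A, hA⟩ := exists_smooth_window 2
  refine ⟨2 ^ 2 * (A * (2 * Real.pi) ^ 2), fun ω x y hω hx => ?_⟩
  obtain ⟨P, hP, hP1, hP0, hPA⟩ := hA x y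
  set c : ℂ := 2 * Real.pi * Complex.I * ω
  have h2π : 1 ≤ 2 * Real.pi := by linarith [Real.two_le_pi]
  have hc : ‖c‖ = 2 * Real.pi := by simp [c, hω, abs_of_pos Real.pi_pos]
  have hc0 : c ≠ 0 := norm_pos_iff.mp (by rw [hc]; positivity)
  have hE : ContDiff ℝ (⊤ : ℕ∞) fun u => expE (ω * u) := contDiff_expE.comp (by fun_prop)
  have hEB (v : ℝ) (i : ℕ) (hi : i ≤ 2) :
      ‖iteratedDeriv i (fun u => expE (ω * u)) v‖ ≤ (2 * Real.pi) ^ 2 := by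
    rw [iteratedDeriv_expE_mul, norm_mul, norm_expE, mul_one, norm_pow, hc]
    exact pow_le_pow_right₀ h2π hi
  -- `W` is a multiple of `V'`, hence has integral zero; the factor makes it `e(ω u)` where `P = 1`.
  set V : ℝ → ℂ := fun u => P u • expE (ω * u)
  have hVtest : IsMellinTest V (x - 1 / |ω|) (y + 1 / |ω|) :=
    ⟨hP.smul hE, by simpa [hω] using hx, fun u hu => by simp [V, hP0 u (by simpa [hω] using hu)]⟩
  have hVB {i : ℕ} (hi : i ≤ 2) (v : ℝ) :
      ‖c⁻¹ • iteratedDeriv i V v‖ ≤ 2 ^ 2 * (A * (2 * Real.pi) ^ 2) := by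
    rw [norm_smul, norm_inv, hc]
    refine (mul_le_of_le_one_left (norm_nonneg _) (inv_le_one_of_one_le₀ h2π)).trans ?_
    exact norm_iteratedDeriv_smul_le (contDiff_infty.mp hP 2) (contDiff_infty.mp hE 2)
      (fun i hi => hPA i hi v) (hEB v) hi
  refine ⟨fun u => c⁻¹ • deriv V u, hVtest.deriv.const_smul c⁻¹, fun u hu => ?_, fun u => ?_,
    fun u => ?_, ?_⟩
  · have hVE : V =ᶠ[𝓝 u] fun u => expE (ω * u) := (hP1 u hu).mono fun v hv => by simp [V, hv]
    rw [hVE.deriv_eq, ← iteratedDeriv_one, iteratedDeriv_expE_mul, pow_one, smul_eq_mul,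
      inv_mul_cancel_left₀ hc0]
  · rw [← iteratedDeriv_one]
    exact hVB one_le_two u
  · rw [deriv_fun_const_smul _ (hVtest.deriv.hasDerivAt u).differentiableAt, hω, mul_one,
      ← iteratedDeriv_one (f := V), ← iteratedDeriv_succ]
    exact hVB le_rfl u
  · rw [mellin_const_smul, hVtest.mellin_deriv_one, smul_zero]

theorem exists_isFrequencyWeight : ∃ B : ℝ, ∀ γ x y : ℝ, γ ≠ 0 → 1 / |γ| < x →
    ∃ W, IsFrequencyWeight W γ x y B := by
  obtain ⟨B, h⟩ := exists_isFrequencyWeight_of_abs_eq_one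
  refine ⟨B, fun γ x y hγ hx => ?_⟩
  have hγ0 : 0 < |γ| := abs_pos.mpr hγ
  obtain ⟨W, hW⟩ := h (γ / |γ|) (|γ| * x) (|γ| * y)
    (by rw [abs_div, abs_abs, div_self hγ0.ne']) ((div_lt_iff₀' hγ0).mp hx)
  refine ⟨fun u => W (|γ| * u), ?_⟩
  simpa only [mul_div_cancel₀ _ hγ0.ne', mul_div_cancel_left₀ _ hγ0.ne'] using
    hW.comp_mul_left hγ0

end SmoothWeight

section QuadraticWeightIntegral

open MeasureTheory

variable {β M : ℝ} {m : ℝ → ℝ} (hβ0 : 0 ≤ β) (hβ : β < 2) (hM : 0 ≤ M) (hm : LocallyIntegrable m)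
  (hm0 : ∀ t, 0 ≤ m t) (hmom : ∀ T : ℝ, 1 ≤ T → ∫ t in (-T)..T, m t ≤ M * (1 + T) ^ β)
include hβ0 hβ hM hm hm0 hmom

theorem integrable_div_sq_add_sq {T : ℝ} (hT : 1 ≤ T) :
    Integrable fun t => m t / (T ^ 2 + t ^ 2) := by
  refine ⟨hm.aestronglyMeasurable.div₀ (by fun_prop), ?_⟩
  rw [hasFiniteIntegral_iff_ofReal (ae_of_all _ fun t => div_nonneg (hm0 t) (by positivity))]
  exact (lintegral_div_sq_add_sq_le hβ0 hβ hM hm hm0 hmom hT).trans_lt ENNReal.ofReal_lt_top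

theorem integral_div_sq_add_sq_le {T : ℝ} (hT : 1 ≤ T) :
    ∫ t, m t / (T ^ 2 + t ^ 2) ≤ 2 ^ (β + 1) / (2 - β) * M * T ^ (β - 2) := by
  rw [integral_eq_lintegral_of_nonneg_ae
    (ae_of_all _ fun t => div_nonneg (hm0 t) (by positivity))
    (integrable_div_sq_add_sq hβ0 hβ hM hm hm0 hmom hT).aestronglyMeasurable]
  exact ENNReal.toReal_le_of_le_ofReal (by positivity)
    (lintegral_div_sq_add_sq_le hβ0 hβ hM hm hm0 hmom hT)

end QuadraticWeightIntegral

namespace IsMellinTest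

open MeasureTheory

variable {W : ℝ → ℂ} {a b : ℝ}

theorem integrable_sq_add_sq_mul_norm_sq_mellin_half (hW : IsMellinTest W a b) (T : ℝ) :
    Integrable fun t : ℝ => (T ^ 2 + t ^ 2) * ‖mellin W (1 / 2 + t * Complex.I)‖ ^ 2 := by
  simp_rw [add_mul]
  exact (hW.memLp_two_mellin_half.norm.integrable_sq.const_mul _).add
    hW.integrable_sq_mul_norm_sq_mellin_half

theorem integral_sq_add_sq_mul_norm_sq_mellin_half_le (hW : IsMellinTest W a b) (hab : a ≤ b)
    {B T : ℝ} (hB : ∀ u, ‖W u‖ ≤ B) (hT : ∀ u, ‖u • deriv W u‖ ≤ T * B) :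
    ∫ t : ℝ, (T ^ 2 + t ^ 2) * ‖mellin W (1 / 2 + t * Complex.I)‖ ^ 2 ≤
      4 * Real.pi * (T ^ 2 * B ^ 2 * (b - a)) := by
  simp_rw [add_mul]
  rw [integral_add (hW.memLp_two_mellin_half.norm.integrable_sq.const_mul _)
    hW.integrable_sq_mul_norm_sq_mellin_half, integral_const_mul]
  have h₁ := mul_le_mul_of_nonneg_left (hW.integral_norm_sq_mellin_half_le hab hB) (sq_nonneg T)
  have h₂ := hW.integral_sq_mul_norm_sq_mellin_half_le hab hT
  linarith

end IsMellinTest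

namespace IsLContinuation

open MeasureTheory

variable {f : ArithmeticFunction ℂ} {q : ℕ} {χ : DirichletCharacter ℂ q} {Λ : ℂ → ℂ} {β M : ℝ}
  {W : ℝ → ℂ} {a b T : ℝ}

theorem continuous_half (hΛ : IsLContinuation f χ Λ) :
    Continuous fun t : ℝ => Λ (1 / 2 + t * Complex.I) := by
  simpa using hΛ.continuous_vertical (σ := 1 / 2) (by norm_num) (by norm_num)

variable (hΛ : IsLContinuation f χ Λ) (hβ0 : 0 ≤ β) (hβ : β < 2) (hM : 0 ≤ M)
  (hmom : ∀ T : ℝ, 1 ≤ T →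
    ∫ t in (-T)..T, ‖Λ (1 / 2 + t * Complex.I)‖ ^ 2 ≤ M * (1 + T) ^ β)
include hΛ hβ0 hβ hM hmom

theorem integrable_norm_sq_div_sq_add_sq (hT : 1 ≤ T) :
    Integrable fun t : ℝ => ‖Λ (1 / 2 + t * Complex.I)‖ ^ 2 / (T ^ 2 + t ^ 2) :=
  integrable_div_sq_add_sq hβ0 hβ hM (hΛ.continuous_half.norm.pow 2).locallyIntegrable
    (fun _ => sq_nonneg _) hmom hT

theorem integrable_mul_mellin_half (hW : IsMellinTest W a b) :
    Integrable fun t : ℝ => Λ (1 / 2 + t * Complex.I) * mellin W (1 / 2 + t * Complex.I) := by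
  refine (integrable_norm_iff (hΛ.continuous_half.aestronglyMeasurable.mul
    hW.memLp_two_mellin_half.aestronglyMeasurable)).mp ?_
  simp only [Pi.mul_apply, norm_mul]
  exact integrable_mul_of_weight hΛ.continuous_half.norm.aemeasurable
    hW.memLp_two_mellin_half.norm.aestronglyMeasurable.aemeasurable (by fun_prop)
    (fun t => by positivity) (hΛ.integrable_norm_sq_div_sq_add_sq hβ0 hβ hM hmom le_rfl)
    (hW.integrable_sq_add_sq_mul_norm_sq_mellin_half 1)

theorem integral_norm_mul_mellin_half_le (hW : IsMellinTest W a b) (hab : a ≤ b) {B : ℝ}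
    (hB : ∀ u, ‖W u‖ ≤ B) (hT : 1 ≤ T) (hWT : ∀ u, ‖u • deriv W u‖ ≤ T * B) :
    ∫ t : ℝ, ‖Λ (1 / 2 + t * Complex.I)‖ * ‖mellin W (1 / 2 + t * Complex.I)‖ ≤
      2 * Real.pi * (B * √(2 ^ (β + 1) / (2 - β) * (M * T ^ β * (b - a)))) := by
  have hT0 : 0 < T := zero_lt_one.trans_le hT
  have hB0 : 0 ≤ B := (norm_nonneg _).trans (hB 0)
  have hTβ : T ^ β = T ^ (β - 2) * T ^ 2 := by
    rw [← Real.rpow_natCast, ← Real.rpow_add hT0]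
    norm_num
  calc _ ≤ √(2 ^ (β + 1) / (2 - β) * M * T ^ (β - 2)) *
          √(4 * Real.pi * (T ^ 2 * B ^ 2 * (b - a))) := by
        refine (integral_mul_le_sqrt_mul_sqrt_of_weight hΛ.continuous_half.norm.aemeasurable
          hW.memLp_two_mellin_half.norm.aestronglyMeasurable.aemeasurable
          (w := fun t => T ^ 2 + t ^ 2) (by fun_prop) (fun _ => norm_nonneg _)
          (fun _ => norm_nonneg _) (fun t => by positivity)
          (hΛ.integrable_norm_sq_div_sq_add_sq hβ0 hβ hM hmom hT)
          (hW.integrable_sq_add_sq_mul_norm_sq_mellin_half T)).trans ?_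
        gcongr
        · exact integral_div_sq_add_sq_le hβ0 hβ hM
            (hΛ.continuous_half.norm.pow 2).locallyIntegrable (fun _ => sq_nonneg _) hmom hT
        · exact hW.integral_sq_add_sq_mul_norm_sq_mellin_half_le hab hB hWT
    _ = √(4 * Real.pi * B ^ 2 * (2 ^ (β + 1) / (2 - β) * (M * T ^ β * (b - a)))) := by
        rw [← Real.sqrt_mul (by positivity), hTβ]
        ring_nf
    _ ≤ √((2 * Real.pi * B) ^ 2 * (2 ^ (β + 1) / (2 - β) * (M * T ^ β * (b - a)))) := by
        gcongr
        nlinarith [Real.two_le_pi, mul_nonneg Real.pi_pos.le (sq_nonneg B)]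
    _ = _ := by
        rw [Real.sqrt_mul (sq_nonneg _), Real.sqrt_sq (by positivity)]
        ring

theorem norm_tsum_mul_le (hsum : LSeriesSummable (fun n => f n * χ n) 2)
    (hW : IsMellinTest W a b) (hab : a ≤ b) {B : ℝ} (hB : ∀ u, ‖W u‖ ≤ B) (hT : 1 ≤ T)
    (hWT : ∀ u, ‖u • deriv W u‖ ≤ T * B) (hW1 : mellin W 1 = 0) :
    ‖∑' n : ℕ, f n * χ n * W n‖ ≤ B * √(2 ^ (β + 1) / (2 - β) * (M * T ^ β * (b - a))) := by
  have hint := hΛ.integrable_mul_mellin_half hβ0 hβ hM hmom hW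
  have h2π : ‖(2 * Real.pi : ℂ)⁻¹‖ = (2 * Real.pi)⁻¹ := by
    simp [abs_of_pos Real.pi_pos]
  rw [(hΛ.hasSum_mul_mellin_half hsum hW hW1 hint).tsum_eq, norm_mul, h2π,
    inv_mul_le_iff₀ (by positivity)]
  refine (norm_integral_le_integral_norm _).trans ?_
  simp only [norm_mul]
  exact hΛ.integral_norm_mul_mellin_half_le hβ0 hβ hM hmom hW hab hB hT hWT

end IsLContinuation

namespace IsFrequencyWeight

variable {W : ℝ → ℂ} {γ x y B : ℝ}

theorem nonneg (hW : IsFrequencyWeight W γ x y B) : 0 ≤ B :=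
  (norm_nonneg _).trans (hW.norm_le 0)

theorem pos (hW : IsFrequencyWeight W γ x y B) : 0 < x :=
  (one_div_nonneg.mpr (abs_nonneg γ)).trans_lt (sub_pos.mp hW.isMellinTest.pos)

theorem norm_smul_deriv_le (hW : IsFrequencyWeight W γ x y B) (hγ : γ ≠ 0) (hxy : x ≤ y) (u : ℝ) :
    ‖u • deriv W u‖ ≤ (|γ| * y + 1) * B := by
  have hy : 0 < y := hW.pos.trans_le hxy
  have hB := hW.nonneg
  by_cases hu : u ∈ Set.Icc (x - 1 / |γ|) (y + 1 / |γ|)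
  · rw [norm_smul, Real.norm_of_nonneg (hW.isMellinTest.pos.le.trans hu.1)]
    calc u * ‖deriv W u‖ ≤ (y + 1 / |γ|) * (B * |γ|) := by
          gcongr
          exacts [hu.2, hW.norm_deriv_le u]
      _ = (|γ| * y + 1) * B := by field_simp
  · rw [hW.isMellinTest.deriv.eq_zero u hu, smul_zero, norm_zero]
    positivity

end IsFrequencyWeight

namespace ClassF

variable {k : ℕ} {α : ℝ} {g : ArithmeticFunction ℂ}

theorem exists_norm_le_rpow (hg : ClassF k α g) {δ : ℝ} (hδ : 0 < δ) :
    ∃ C : ℝ, 0 < C ∧ ∀ n : ℕ, ‖g n‖ ≤ C * (n : ℝ) ^ δ := by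
  obtain ⟨C, hC, h⟩ := exists_divisorK_le_rpow k hδ
  exact ⟨C, hC, fun n => (hg.divisor_bound n).trans (h n)⟩

theorem lseriesSummable_two (hg : ClassF k α g) {q : ℕ} (χ : DirichletCharacter ℂ q) :
    LSeriesSummable (fun n => g n * χ n) 2 := by
  obtain ⟨C, -, h⟩ := hg.exists_norm_le_rpow (by norm_num : (0 : ℝ) < 1 / 2)
  refine LSeriesSummable_of_le_const_mul_rpow (x := 3 / 2) (by norm_num) ⟨C, fun n _ => ?_⟩
  rw [norm_mul, show (3 / 2 - 1 : ℝ) = 1 / 2 by norm_num]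
  exact (mul_le_of_le_one_right (norm_nonneg _) (χ.norm_le_one _)).trans (h n)

theorem exists_norm_tsum_mul_le (hg : ClassF k α g) (hα0 : 0 ≤ α) {κ : ℝ} (hκ : 0 < κ)
    (hακ : α + κ < 1) :
    ∃ C : ℝ, 0 ≤ C ∧ ∀ (q : ℕ) (χ : DirichletCharacter ℂ q) (W : ℝ → ℂ) (γ x y B : ℝ),
      0 < q → γ ≠ 0 → x ≤ y → IsFrequencyWeight W γ x y B →
      ‖∑' n : ℕ, g n * χ n * W n‖ ≤
        C * B * √((q : ℝ) ^ κ * (|γ| * y + 1) ^ (1 + α + κ) * (y - x + 2 / |γ|)) := by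
  obtain ⟨Λ, hΛ, hmom⟩ := hg.analytic
  obtain ⟨M, hM⟩ := hmom √κ (Real.sqrt_pos.mpr hκ)
  simp only [Real.sq_sqrt hκ.le] at hM
  set β : ℝ := 1 + α + κ
  have hβ0 : 0 ≤ β := by positivity
  have hβ2 : 0 < 2 - β := by linarith
  refine ⟨√(2 ^ (β + 1) / (2 - β) * max M 0), by positivity,
    fun q χ W γ x y B hq hγ hxy hW => ?_⟩
  have hy : 0 < y := hW.pos.trans_le hxy
  have hγ0 : 0 < 1 / |γ| := one_div_pos.mpr (abs_pos.mpr hγ)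
  have h := (hΛ q hq χ).norm_tsum_mul_le hβ0 (sub_pos.mp hβ2) (M := max M 0 * (q : ℝ) ^ κ)
    (by positivity) (fun T hT => (hM q hq χ T hT).trans (by gcongr; exact le_max_left M 0))
    (hg.lseriesSummable_two χ) hW.isMellinTest (by linarith) hW.norm_le
    (le_add_of_nonneg_left (by positivity)) (hW.norm_smul_deriv_le hγ hxy) hW.mellin_one
  refine h.trans_eq ?_
  rw [mul_comm _ B, mul_assoc B, ← Real.sqrt_mul (by positivity)]
  ring_nf

theorem exists_norm_sum_mul_dilate_le (hg : ClassF k α g) (hα0 : 0 ≤ α) {κ : ℝ} (hκ : 0 < κ)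
    (hακ : α + κ < 1) :
    ∃ C : ℝ, 0 ≤ C ∧ ∀ (q : ℕ) (χ : DirichletCharacter ℂ q) (W : ℝ → ℂ) (γ x y B : ℝ) (d : ℕ),
      0 < q → γ ≠ 0 → x ≤ y → IsFrequencyWeight W γ x y B → 0 < d →
      ‖∑ n ∈ Finset.Icc 1 ⌊y + 1 / |γ|⌋₊, g n * χ n * W (d * n : ℕ)‖ ≤
        C * B * √((q : ℝ) ^ κ * (|γ| * y + 1) ^ (1 + α + κ) * (y - x + 2 / |γ|)) *
          (d : ℝ) ^ (-(1 / 2) : ℝ) := by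
  obtain ⟨C, hC, h⟩ := hg.exists_norm_tsum_mul_le hα0 hκ hακ
  refine ⟨C, hC, fun q χ W γ x y B d hq hγ hxy hW hd => ?_⟩
  have hd0 : (0 : ℝ) < d := by exact_mod_cast hd
  have htsum : ∑' n : ℕ, g n * χ n * W (d * n) =
      ∑ n ∈ Finset.Icc 1 ⌊y + 1 / |γ|⌋₊, g n * χ n * W (d * n : ℕ) := by
    push_cast
    refine tsum_eq_sum fun n hn => ?_
    obtain rfl | hn0 := n.eq_zero_or_pos
    · simp
    rw [hW.isMellinTest.eq_zero _ fun hdn => hn ?_, mul_zero]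
    have hn1 : (n : ℝ) ≤ d * n := by exact_mod_cast Nat.le_mul_of_pos_left n hd
    exact Finset.mem_Icc.mpr ⟨hn0, Nat.le_floor (hn1.trans hdn.2)⟩
  rw [← htsum]
  refine (h q χ _ _ _ _ B hq (mul_ne_zero hd0.ne' hγ) (by gcongr)
    (hW.comp_mul_left hd0)).trans_eq ?_
  have hT : |d * γ| * (y / d) + 1 = |γ| * y + 1 := by
    rw [abs_mul, abs_of_pos hd0]
    field_simp
  have hL : y / d - x / d + 2 / |d * γ| = (y - x + 2 / |γ|) * (d : ℝ)⁻¹ := by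
    rw [abs_mul, abs_of_pos hd0]
    field_simp
  have hdpow : √(d : ℝ)⁻¹ = (d : ℝ) ^ (-(1 / 2) : ℝ) := by
    rw [Real.sqrt_inv, Real.sqrt_eq_rpow, Real.rpow_neg hd0.le]
  rw [hT, hL, ← mul_assoc, Real.sqrt_mul' _ (by positivity), hdpow, mul_assoc (C * B)]

end ClassF

theorem expE_natCast_mul_intCast_div (m : ℕ) (r : ℤ) (q : ℕ) [NeZero q] :
    expE (m * (r / q)) = ZMod.stdAddChar ((m : ZMod q) * (r : ZMod q)) := by
  have h := ZMod.stdAddChar_coe (N := q) (m * r)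
  push_cast at h
  rw [h, expE]
  push_cast
  ring_nf

theorem norm_sum_mul_le_of_norm_sum_dirichletCharacter_le {q : ℕ} [NeZero q] {F : ZMod q → ℂ}
    (hF : ∀ b, ‖F b‖ ≤ 1) (s : Finset ℕ) (h : ℕ → ℂ) {E : ℝ}
    (hE : ∀ χ : DirichletCharacter ℂ q, ‖∑ n ∈ s, h n * χ n‖ ≤ E) :
    ‖∑ n ∈ s with n.Coprime q, h n * F n‖ ≤ √q * E := by
  have hE0 : 0 ≤ E := (norm_nonneg _).trans (hE 1)
  set c := dirichletCoeff fun b : (ZMod q)ˣ => F b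
  have hexpand : ∑ n ∈ s with n.Coprime q, h n * F n = ∑ χ, c χ * ∑ n ∈ s, h n * χ n := by
    simp_rw [Finset.mul_sum]
    rw [Finset.sum_comm, Finset.sum_filter]
    refine Finset.sum_congr rfl fun n _ => ?_
    split_ifs with hn
    · have := sum_dirichletCoeff_mul (fun b : (ZMod q)ˣ => F b) (ZMod.unitOfCoprime n hn)
      rw [ZMod.coe_unitOfCoprime] at this
      rw [← this, Finset.mul_sum]
      exact Finset.sum_congr rfl fun χ _ => by ring
    · refine (Finset.sum_eq_zero fun χ _ => ?_).symm
      rw [χ.map_nonunit fun hu => hn ((ZMod.isUnit_iff_coprime n q).mp hu), mul_zero, mul_zero]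
  calc _ = ‖∑ χ, c χ * ∑ n ∈ s, h n * χ n‖ := by rw [hexpand]
    _ ≤ ∑ χ, ‖c χ‖ * E := norm_sum_le_of_le _ fun χ _ => by rw [norm_mul]; gcongr; exact hE χ
    _ = (∑ χ, ‖c χ‖) * E := by rw [Finset.sum_mul]
    _ ≤ √q * E := by gcongr; exact sum_norm_dirichletCoeff_le _ fun b => hF b

theorem norm_sum_coprime_le_of_norm_sum_dirichletCharacter_le {q : ℕ} [NeZero q]
    {g : ArithmeticFunction ℂ} (hg : g.IsMultiplicative) (r : ℤ) {d : ℕ}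
    (hd : d ∈ Nat.factoredNumbers q.primeFactors) (s : Finset ℕ) (w : ℕ → ℂ) {E : ℝ}
    (hE : ∀ χ : DirichletCharacter ℂ q, ‖∑ n ∈ s, g n * χ n * w (d * n)‖ ≤ E) :
    ‖∑ n ∈ s with n.Coprime q, g (d * n) * expE ((d * n : ℕ) * (r / q)) * w (d * n)‖ ≤
      ‖g d‖ * (√q * E) := by
  have h := norm_sum_mul_le_of_norm_sum_dirichletCharacter_le
    (F := fun b : ZMod q => ZMod.stdAddChar ((d : ZMod q) * b * (r : ZMod q)))
    (fun b => (AddChar.norm_apply _ _).le) s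
    (fun n => g n * w (d * n)) (fun χ => by simpa only [mul_right_comm] using hE χ)
  refine le_of_eq_of_le ?_ (mul_le_mul_of_nonneg_left h (norm_nonneg (g d)))
  rw [← norm_mul, Finset.mul_sum]
  refine congrArg _ (Finset.sum_congr rfl fun n hn => ?_)
  rw [expE_natCast_mul_intCast_div, Nat.cast_mul,
    hg.map_mul_of_coprime (coprime_of_mem_factoredNumbers hd (Finset.mem_filter.mp hn).2)]
  ring

theorem sqrt_mul_sqrt_mul_rpow_le {α κ κ₀ q T L : ℝ} (hα : 0 ≤ α) (hκ₀ : κ₀ ≤ κ) (hκ : 0 ≤ κ)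
    (hq : 1 ≤ q) (hT : 1 ≤ T) :
    √q * √(q ^ κ₀ * T ^ (1 + α + κ₀) * L) * q ^ (κ / 2) ≤
      (q * T) ^ ((1 + α) / 2 + κ) * √L := by
  have hq0 : 0 < q := zero_lt_one.trans_le hq
  have hT0 : 0 < T := zero_lt_one.trans_le hT
  calc √q * √(q ^ κ₀ * T ^ (1 + α + κ₀) * L) * q ^ (κ / 2)
      = (q ^ ((1 + κ₀ + κ) / 2) * T ^ ((1 + α + κ₀) / 2)) * √L := by
        rw [Real.sqrt_mul (by positivity), Real.sqrt_mul (by positivity), Real.sqrt_eq_rpow q,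
          Real.sqrt_eq_rpow (q ^ κ₀), Real.sqrt_eq_rpow (T ^ _), ← Real.rpow_mul hq0.le,
          ← Real.rpow_mul hT0.le, show (1 + κ₀ + κ) / 2 = 1 / 2 + κ₀ * (1 / 2) + κ / 2 by ring,
          Real.rpow_add hq0, Real.rpow_add hq0]
        ring_nf
    _ ≤ (q ^ ((1 + α) / 2 + κ) * T ^ ((1 + α) / 2 + κ)) * √L := by
        gcongr <;> linarith
    _ = _ := by rw [Real.mul_rpow hq0.le hT0.le]

namespace ClassF

variable {k : ℕ} {α : ℝ} {g : ArithmeticFunction ℂ}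

theorem exists_norm_sum_coprime_mul_weight_le (hg : ClassF k α g) (hα0 : 0 ≤ α) {κ : ℝ}
    (hκ : 0 < κ) (hακ : α + κ < 1) :
    ∃ C : ℝ, 0 ≤ C ∧ ∀ (r : ℤ) (q : ℕ) (W : ℝ → ℂ) (γ x y B : ℝ) (d : ℕ),
      0 < q → γ ≠ 0 → x ≤ y → IsFrequencyWeight W γ x y B → 0 < d →
      d ∈ Nat.factoredNumbers q.primeFactors →
      ‖∑ n ∈ Finset.Icc 1 ⌊y + 1 / |γ|⌋₊ with n.Coprime q,
        g (d * n) * expE ((d * n : ℕ) * (r / q)) * W (d * n : ℕ)‖ ≤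
        C * B * (√q * √((q : ℝ) ^ κ * (|γ| * y + 1) ^ (1 + α + κ) * (y - x + 2 / |γ|))) *
          (d : ℝ) ^ (-(1 / 4) : ℝ) := by
  obtain ⟨C₁, hC₁, htwist⟩ := hg.exists_norm_sum_mul_dilate_le hα0 hκ hακ
  obtain ⟨C₂, hC₂, hgrowth⟩ := hg.exists_norm_le_rpow (by norm_num : (0 : ℝ) < 1 / 4)
  refine ⟨C₁ * C₂, by positivity, fun r q W γ x y B d hq hγ hxy hW hd hdq => ?_⟩
  have : NeZero q := ⟨hq.ne'⟩
  have hB := hW.nonneg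
  have hd0 : (0 : ℝ) < d := by exact_mod_cast hd
  refine (norm_sum_coprime_le_of_norm_sum_dirichletCharacter_le hg.multiplicative r hdq _
    (fun n => W n) fun χ => htwist q χ W γ x y B d hq hγ hxy hW hd).trans ?_
  set S := √((q : ℝ) ^ κ * (|γ| * y + 1) ^ (1 + α + κ) * (y - x + 2 / |γ|))
  calc ‖g d‖ * (√q * (C₁ * B * S * (d : ℝ) ^ (-(1 / 2) : ℝ)))
      ≤ C₂ * (d : ℝ) ^ (1 / 4 : ℝ) * (√q * (C₁ * B * S * (d : ℝ) ^ (-(1 / 2) : ℝ))) := by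
        gcongr
        exact hgrowth d
    _ = C₁ * C₂ * B * (√q * S) * ((d : ℝ) ^ (1 / 4 : ℝ) * (d : ℝ) ^ (-(1 / 2) : ℝ)) := by ring
    _ = _ := by
        rw [← Real.rpow_add hd0]
        norm_num

theorem exists_norm_sum_mul_weight_le (hg : ClassF k α g) (hα0 : 0 ≤ α) (hα1 : α < 1) {κ : ℝ}
    (hκ : 0 < κ) :
    ∃ C : ℝ, 0 ≤ C ∧ ∀ (r : ℤ) (q : ℕ) (W : ℝ → ℂ) (γ x y B : ℝ),
      0 < q → γ ≠ 0 → x ≤ y → IsFrequencyWeight W γ x y B →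
      ‖∑ m ∈ Finset.Icc 1 ⌊y + 1 / |γ|⌋₊, g m * expE (m * (r / q)) * W m‖ ≤
        C * B * ((q * (|γ| * y + 1)) ^ ((1 + α) / 2 + κ) * √(y - x + 2 / |γ|)) := by
  set κ₀ := min κ ((1 - α) / 2)
  have hκ₀ : 0 < κ₀ := lt_min hκ (by linarith)
  obtain ⟨C₁, hC₁, hfiber⟩ := hg.exists_norm_sum_coprime_mul_weight_le hα0 hκ₀
    (by linarith [min_le_right κ ((1 - α) / 2)])
  obtain ⟨C₂, hC₂, hfactored⟩ := exists_sum_factoredNumbers_rpow_le (β := 1 / 4) (δ := κ / 2)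
    (by norm_num) (by positivity)
  refine ⟨C₁ * C₂, by positivity, fun r q W γ x y B hq hγ hxy hW => ?_⟩
  have hB := hW.nonneg
  have hy : 0 < y := hW.pos.trans_le hxy
  have hq1 : (1 : ℝ) ≤ q := by exact_mod_cast hq
  have hT1 : 1 ≤ |γ| * y + 1 := le_add_of_nonneg_left (by positivity)
  have hvanish (m : ℕ) (hm : ⌊y + 1 / |γ|⌋₊ < m) : W m = 0 :=
    hW.isMellinTest.eq_zero _ fun h => (Nat.lt_of_floor_lt hm).not_ge h.2
  rw [sum_Icc_eq_sum_factored_sum_coprime hq.ne' _ fun m hm => by rw [hvanish m hm, mul_zero]]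
  set D := (Finset.Icc 1 ⌊y + 1 / |γ|⌋₊).filter (· ∈ Nat.factoredNumbers q.primeFactors)
  set S := √((q : ℝ) ^ κ₀ * (|γ| * y + 1) ^ (1 + α + κ₀) * (y - x + 2 / |γ|))
  calc _ ≤ ∑ d ∈ D, C₁ * B * (√q * S) * (d : ℝ) ^ (-(1 / 4) : ℝ) :=
        norm_sum_le_of_le _ fun d hd =>
          hfiber r q W γ x y B d hq hγ hxy hW (by grind) (Finset.mem_filter.mp hd).2
    _ = C₁ * B * (√q * S) * ∑ d ∈ D, (d : ℝ) ^ (-(1 / 4) : ℝ) := by rw [Finset.mul_sum]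
    _ ≤ C₁ * B * (√q * S) * (C₂ * (q : ℝ) ^ (κ / 2)) := by
        gcongr
        exact hfactored q hq.ne' D fun d hd => (Finset.mem_filter.mp hd).2
    _ = C₁ * C₂ * B * (√q * S * (q : ℝ) ^ (κ / 2)) := by ring
    _ ≤ _ := mul_le_mul_of_nonneg_left
        (sqrt_mul_sqrt_mul_rpow_le hα0 (min_le_left _ _) hκ.le hq1 hT1) (by positivity)

end ClassF

theorem divisorSum_nonneg (k : ℕ) (u v : ℝ) : 0 ≤ divisorSum k u v :=
  Finset.sum_nonneg fun _ _ => Nat.cast_nonneg _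

theorem divisorSum_mono (k : ℕ) {u u' v v' : ℝ} (hu : u' ≤ u) (hv : v ≤ v') :
    divisorSum k u v ≤ divisorSum k u' v' :=
  Finset.sum_le_sum_of_subset_of_nonneg
    (Finset.Icc_subset_Icc (Nat.ceil_le_ceil hu) (Nat.floor_le_floor hv))
    fun _ _ _ => Nat.cast_nonneg _

theorem exists_divisorSum_le (k : ℕ) {δ : ℝ} (hδ : 0 < δ) :
    ∃ C : ℝ, 0 < C ∧ ∀ u v : ℝ, 0 ≤ u → u ≤ v → divisorSum k u v ≤ C * ((v - u + 1) * v ^ δ) := by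
  obtain ⟨C, hC, hd⟩ := exists_divisorK_le_rpow k hδ
  refine ⟨C, hC, fun u v hu huv => ?_⟩
  have hv : 0 ≤ v := hu.trans huv
  have hcard : ((Finset.Icc ⌈u⌉₊ ⌊v⌋₊).card : ℝ) ≤ v - u + 1 := by
    rw [Nat.card_Icc]
    rcases le_total ⌈u⌉₊ (⌊v⌋₊ + 1) with h | h
    · push_cast [Nat.cast_sub h]
      linarith [Nat.le_ceil u, Nat.floor_le hv]
    · rw [Nat.sub_eq_zero_of_le h, Nat.cast_zero]
      linarith
  calc divisorSum k u v ≤ ∑ _m ∈ Finset.Icc ⌈u⌉₊ ⌊v⌋₊, C * v ^ δ :=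
        Finset.sum_le_sum fun m hm => (hd m).trans <| by
          gcongr
          exact (Nat.le_floor_iff hv).mp (Finset.mem_Icc.mp hm).2
    _ = (Finset.Icc ⌈u⌉₊ ⌊v⌋₊).card * (C * v ^ δ) := by rw [Finset.sum_const, nsmul_eq_mul]
    _ ≤ (v - u + 1) * (C * v ^ δ) := by gcongr
    _ = _ := by ring

theorem exists_divisorSum_add_divisorSum_le (k : ℕ) {δ : ℝ} (hδ : 0 < δ) :
    ∃ C : ℝ, 0 < C ∧ ∀ X x H h : ℝ, X ≤ x → x ≤ 2 * X → 0 ≤ H → H ≤ X → 0 ≤ h → h ≤ X →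
      divisorSum k (x - h) x + divisorSum k (x + H) (x + H + h) ≤ C * ((h + 1) * X ^ δ) := by
  obtain ⟨C, hC, hsum⟩ := exists_divisorSum_le k hδ
  refine ⟨2 * C * 4 ^ δ, by positivity, fun X x H h hXx hx hH0 hHX hh0 hhX => ?_⟩
  have hX0 : 0 ≤ X := hH0.trans hHX
  have hedge (u : ℝ) (hu : 0 ≤ u) (hu4 : u + h ≤ 4 * X) :
      divisorSum k u (u + h) ≤ C * 4 ^ δ * ((h + 1) * X ^ δ) := by
    calc divisorSum k u (u + h) ≤ C * ((u + h - u + 1) * (u + h) ^ δ) :=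
          hsum _ _ hu (le_add_of_nonneg_right hh0)
      _ ≤ C * ((h + 1) * (4 * X) ^ δ) := by
          rw [add_sub_cancel_left]
          gcongr
      _ = _ := by
          rw [Real.mul_rpow (by norm_num) hX0]
          ring
  have hleft := hedge (x - h) (by linarith) (by linarith)
  have hright := hedge (x + H) (by linarith) (by linarith)
  rw [sub_add_cancel] at hleft
  linarith

theorem exists_rpow_mul_rpow_le {ε : ℝ} (hε : 0 < ε) :
    ∃ δ : ℝ, 0 < δ ∧ δ ≤ 1 / 2 ∧ ∀ (j : ℕ) (η H X : ℝ), η ≤ 1 → 1 ≤ H → H ≤ X →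
      H ^ (η - ε / 2) * X ^ δ ≤ 3 * (X ^ (1 / 2 : ℝ) + H ^ η * Real.log X ^ j) := by
  refine ⟨min (ε / 6) (1 / 6), by positivity, (min_le_right _ _).trans (by norm_num),
    fun j η H X hη hH1 hHX => ?_⟩
  set δ := min (ε / 6) (1 / 6 : ℝ)
  have hδ : δ ≤ 1 / 6 := min_le_right _ _
  have hX1 : 1 ≤ X := hH1.trans hHX
  have hX0 : 0 < X := zero_lt_one.trans_le hX1
  have hH0 : 0 < H := zero_lt_one.trans_le hH1
  have hHη : H ^ (η - ε / 2) ≤ H := Real.rpow_le_self_of_one_le hH1 (by linarith)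
  have hhalf0 : 0 ≤ X ^ (1 / 2 : ℝ) := by positivity
  have hlog0 : 0 ≤ H ^ η * Real.log X ^ j := by
    have := Real.log_nonneg hX1
    positivity
  rcases lt_or_ge H (X ^ (1 / 3 : ℝ)) with hsmall | hlarge
  · calc H ^ (η - ε / 2) * X ^ δ ≤ X ^ (1 / 3 : ℝ) * X ^ (1 / 6 : ℝ) := by
          gcongr
          exact hHη.trans hsmall.le
      _ = X ^ (1 / 2 : ℝ) := by rw [← Real.rpow_add hX0]; norm_num
      _ ≤ _ := by linarith
  rcases lt_or_ge X 3 with hX3 | hX3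
  · calc H ^ (η - ε / 2) * X ^ δ ≤ 3 * X ^ (1 / 2 : ℝ) := by
          gcongr
          · linarith
          · linarith
      _ ≤ _ := by linarith
  · have hlog1 : 1 ≤ Real.log X :=
      (Real.le_log_iff_exp_le hX0).mpr (Real.exp_one_lt_three.le.trans hX3)
    have hXH : X ^ δ ≤ H ^ (ε / 2) := by
      calc X ^ δ ≤ X ^ (1 / 3 * (ε / 2)) := by
            gcongr
            · linarith [min_le_left (ε / 6) (1 / 6 : ℝ)]
        _ = (X ^ (1 / 3 : ℝ)) ^ (ε / 2) := Real.rpow_mul hX0.le _ _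
        _ ≤ H ^ (ε / 2) := by gcongr
    calc H ^ (η - ε / 2) * X ^ δ ≤ H ^ (η - ε / 2) * H ^ (ε / 2) := by gcongr
      _ = H ^ η := by rw [← Real.rpow_add hH0, sub_add_cancel]
      _ ≤ H ^ η * Real.log X ^ j := le_mul_of_one_le_right (by positivity) (one_le_pow₀ hlog1)
      _ ≤ _ := by linarith

theorem exists_divisorSum_add_divisorSum_le_log (k : ℕ) {ε : ℝ} (hε : 0 < ε) :
    ∃ C : ℝ, 0 < C ∧ ∀ (j : ℕ) (η X x H h : ℝ), η ≤ 1 → X ≤ x → x ≤ 2 * X → 1 ≤ H → H ≤ X →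
      0 ≤ h → h ≤ H ^ (η - ε / 2) →
      divisorSum k (x - h) x + divisorSum k (x + H) (x + H + h) ≤
        C * (X ^ (1 / 2 : ℝ) + H ^ η * Real.log X ^ j) := by
  obtain ⟨δ, hδ0, hδ, hpow⟩ := exists_rpow_mul_rpow_le hε
  obtain ⟨C, hC, hsum⟩ := exists_divisorSum_add_divisorSum_le k hδ0
  refine ⟨4 * C, by positivity, fun j η X x H h hη hXx hx hH1 hHX hh0 hh => ?_⟩
  have hX1 : 1 ≤ X := hH1.trans hHX
  have hhX : h ≤ X :=
    (hh.trans (Real.rpow_le_self_of_one_le hH1 (by linarith))).trans hHX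
  have hlog0 : 0 ≤ H ^ η * Real.log X ^ j := by
    have := Real.log_nonneg hX1
    positivity
  have hXδ : X ^ δ ≤ X ^ (1 / 2 : ℝ) := Real.rpow_le_rpow_of_exponent_le hX1 hδ
  calc _ ≤ C * ((h + 1) * X ^ δ) := hsum X x H h hXx hx (by linarith) hHX hh0 hhX
    _ ≤ C * (H ^ (η - ε / 2) * X ^ δ + X ^ δ) := by
        rw [add_one_mul]
        gcongr
    _ ≤ C * (3 * (X ^ (1 / 2 : ℝ) + H ^ η * Real.log X ^ j) +
          (X ^ (1 / 2 : ℝ) + H ^ η * Real.log X ^ j)) := by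
        refine mul_le_mul_of_nonneg_left (add_le_add (hpow j η H X hη hH1 hHX) ?_) hC.le
        exact hXδ.trans (le_add_of_nonneg_right hlog0)
    _ = _ := by ring

theorem rpow_half_le_rpow_mul_rpow_half {q γ X H κ : ℝ} (hq : 1 ≤ q) (hγ : 0 ≤ γ) (hHX : H ≤ X)
    (hγH : 1 ≤ γ * H) (hκ : 0 ≤ κ) :
    X ^ (1 / 2 : ℝ) ≤ (q * γ * X) ^ (1 / 2 + κ) * H ^ (1 / 2 : ℝ) := by
  have hH : 0 < H := pos_of_mul_pos_right (zero_lt_one.trans_le hγH) hγ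
  have hX : 0 < X := hH.trans_le hHX
  have hqγ : γ ≤ q * γ := le_mul_of_one_le_left hγ hq
  have hbase : 1 ≤ q * γ * X := hγH.trans (by gcongr)
  calc X ^ (1 / 2 : ℝ) ≤ (q * γ * X * H) ^ (1 / 2 : ℝ) := by
        gcongr
        calc X ≤ γ * H * X := le_mul_of_one_le_left hX.le hγH
          _ = γ * X * H := mul_right_comm γ H X
          _ ≤ q * γ * X * H := by gcongr
    _ = (q * γ * X) ^ (1 / 2 : ℝ) * H ^ (1 / 2 : ℝ) := Real.mul_rpow (by positivity) hH.le
    _ ≤ _ := by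
        gcongr
        linarith

namespace IsFrequencyWeight

variable {W : ℝ → ℂ} {γ x y B : ℝ}

theorem mem_edges_of_ne_zero (hW : IsFrequencyWeight W γ x y B) {m : ℕ} (hm : W m ≠ 0)
    (hmxy : m ∉ Finset.Icc ⌈x⌉₊ ⌊y⌋₊) :
    m ∈ Finset.Icc ⌈x - 1 / |γ|⌉₊ ⌊x⌋₊ ∪ Finset.Icc ⌈y⌉₊ ⌊y + 1 / |γ|⌋₊ := by
  obtain ⟨hlow, hhigh⟩ : (m : ℝ) ∈ Set.Icc (x - 1 / |γ|) (y + 1 / |γ|) :=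
    not_imp_comm.mp (hW.isMellinTest.eq_zero m) hm
  have hm' : m < ⌈x⌉₊ ∨ ⌊y⌋₊ < m := by grind
  rcases hm' with h | h
  · exact Finset.mem_union_left _ (Finset.mem_Icc.mpr
      ⟨Nat.ceil_le.mpr hlow, Nat.le_floor (Nat.lt_ceil.mp h).le⟩)
  · exact Finset.mem_union_right _ (Finset.mem_Icc.mpr
      ⟨Nat.ceil_le.mpr (Nat.lt_of_floor_lt h).le, Nat.le_floor hhigh⟩)

theorem shortExpSum_eq_sum {H : ℝ} (hW : IsFrequencyWeight W γ x (x + H) B) (hH : 0 ≤ H)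
    (g : ArithmeticFunction ℂ) (θ : ℝ) :
    shortExpSum g x H (θ + γ) =
      ∑ m ∈ Finset.Icc ⌈x⌉₊ ⌊x + H⌋₊, g m * expE (m * θ) * W m :=
  Finset.sum_congr rfl fun m hm => by
    obtain ⟨hxm, hmH⟩ := Finset.mem_Icc.mp hm
    rw [Nat.ceil_le] at hxm
    rw [Nat.le_floor_iff (add_nonneg hW.pos.le hH)] at hmH
    rw [mul_add, expE_add, mul_comm (m : ℝ) γ, ← hW.eq_expE m ⟨hxm, hmH⟩, ← mul_assoc]

theorem norm_sum_sub_shortExpSum_le {H : ℝ} (hW : IsFrequencyWeight W γ x (x + H) B) (hH : 0 ≤ H)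
    {k : ℕ} {g : ArithmeticFunction ℂ} (hg : ∀ n, ‖g n‖ ≤ divisorK k n) (θ : ℝ) :
    ‖∑ m ∈ Finset.Icc 1 ⌊x + H + 1 / |γ|⌋₊, g m * expE (m * θ) * W m - shortExpSum g x H (θ + γ)‖ ≤
      B * (divisorSum k (x - 1 / |γ|) x + divisorSum k (x + H) (x + H + 1 / |γ|)) := by
  set f : ℕ → ℂ := fun m => g m * expE (m * θ) * W m
  set I := Finset.Icc ⌈x⌉₊ ⌊x + H⌋₊
  set J := Finset.Icc 1 ⌊x + H + 1 / |γ|⌋₊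
  set E₁ := Finset.Icc ⌈x - 1 / |γ|⌉₊ ⌊x⌋₊
  set E₂ := Finset.Icc ⌈x + H⌉₊ ⌊x + H + 1 / |γ|⌋₊
  have hIJ : I ⊆ J := Finset.Icc_subset_Icc (Nat.one_le_ceil_iff.mpr hW.pos)
    (Nat.floor_le_floor (le_add_of_nonneg_right (by positivity)))
  have hedges : (J \ I).filter (fun m => f m ≠ 0) ⊆ E₁ ∪ E₂ := fun m hm => by
    obtain ⟨hmJI, hfm⟩ := Finset.mem_filter.mp hm
    exact hW.mem_edges_of_ne_zero (right_ne_zero_of_mul hfm) (Finset.mem_sdiff.mp hmJI).2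
  have hf (m : ℕ) : ‖f m‖ ≤ B * divisorK k m := by
    rw [norm_mul, norm_mul, norm_expE, mul_one, mul_comm B]
    exact mul_le_mul (hg m) (hW.norm_le m) (norm_nonneg _) (Nat.cast_nonneg _)
  calc _ = ‖∑ m ∈ J \ I with f m ≠ 0, f m‖ := by
        rw [hW.shortExpSum_eq_sum hH, Finset.sum_filter_ne_zero, Finset.sum_sdiff_eq_sub hIJ]
    _ ≤ ∑ m ∈ E₁ ∪ E₂, B * divisorK k m := (norm_sum_le_of_le _ fun m _ => hf m).trans
        (Finset.sum_le_sum_of_subset_of_nonneg hedges fun m _ _ => (norm_nonneg _).trans (hf m))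
    _ ≤ ∑ m ∈ E₁, B * (divisorK k m : ℝ) + ∑ m ∈ E₂, B * (divisorK k m : ℝ) := by
        rw [← Finset.sum_union_inter]
        exact le_add_of_nonneg_right (Finset.sum_nonneg fun m _ => (norm_nonneg _).trans (hf m))
    _ = _ := by rw [← Finset.mul_sum, ← Finset.mul_sum, ← mul_add, divisorSum, divisorSum]

end IsFrequencyWeight

theorem rpow_mul_sqrt_le_rpow_mul_rpow_half {q γ X x H e : ℝ} (hq : 0 ≤ q) (hγ : 0 < γ)
    (hx0 : 0 ≤ x) (hx : x ≤ 2 * X) (hHX : H ≤ X) (hγH : 2 / γ ≤ H) (he : 0 ≤ e) :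
    (q * (γ * (x + H) + 1)) ^ e * √(x + H - x + 2 / γ) ≤
      4 ^ e * √2 * ((q * γ * X) ^ e * H ^ (1 / 2 : ℝ)) := by
  have hH : 0 < H := (by positivity : 0 < 2 / γ).trans_le hγH
  have hX : 0 < X := hH.trans_le hHX
  have hγX : 2 ≤ γ * X := ((div_le_iff₀' hγ).mp hγH).trans (by gcongr)
  calc (q * (γ * (x + H) + 1)) ^ e * √(x + H - x + 2 / γ)
      ≤ (q * (4 * (γ * X))) ^ e * √(2 * H) := by
        gcongr
        · nlinarith
        · linarith
    _ = _ := by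
        rw [show q * (4 * (γ * X)) = 4 * (q * γ * X) by ring,
          Real.mul_rpow (by norm_num) (by positivity), Real.sqrt_mul (by norm_num),
          Real.sqrt_eq_rpow H]
        ring

theorem ClassF.exists_norm_shortExpSum_le {k : ℕ} {α : ℝ} {g : ArithmeticFunction ℂ}
    (hg : ClassF k α g) (hα0 : 0 ≤ α) (hα1 : α < 1) {κ : ℝ} (hκ : 0 < κ) :
    ∃ C : ℝ, 0 < C ∧ ∀ (X x H γ : ℝ) (r : ℤ) (q : ℕ), 0 < q → X ≤ x → x ≤ 2 * X → H ≤ X →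
      γ ≠ 0 → 2 / |γ| ≤ H →
      ‖shortExpSum g x H (r / q + γ)‖ ≤
        C * ((q * |γ| * X) ^ ((1 + α) / 2 + κ) * H ^ (1 / 2 : ℝ)
          + (divisorSum k (x - 1 / |γ|) x + divisorSum k (x + H) (x + H + 1 / |γ|))) := by
  obtain ⟨B, hweight⟩ := exists_isFrequencyWeight
  obtain ⟨C, hC, hsmooth⟩ := hg.exists_norm_sum_mul_weight_le hα0 hα1 hκ
  set e := (1 + α) / 2 + κ
  set A := C * |B| * (4 ^ e * √2)
  refine ⟨A + |B| + 1, by positivity, fun X x H γ r q hq hXx hx hHX hγ hγH => ?_⟩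
  have hγ0 : 0 < |γ| := abs_pos.mpr hγ
  have hH0 : 0 < H := (by positivity : 0 < 2 / |γ|).trans_le hγH
  have hX0 : 0 < X := hH0.trans_le hHX
  have hγx : 1 / |γ| < x := (by gcongr; norm_num : 1 / |γ| < 2 / |γ|).trans_le (by linarith)
  obtain ⟨W, hW⟩ := hweight γ x (x + H) hγ hγx
  have hB : |B| = B := abs_of_nonneg hW.nonneg
  set S := ∑ m ∈ Finset.Icc 1 ⌊x + H + 1 / |γ|⌋₊, g m * expE (m * (r / q)) * W m
  set Z := (q * |γ| * X) ^ e * H ^ (1 / 2 : ℝ)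
  set Y := divisorSum k (x - 1 / |γ|) x + divisorSum k (x + H) (x + H + 1 / |γ|)
  have hS : ‖S‖ ≤ A * Z := by
    calc ‖S‖ ≤ C * |B| * ((q * (|γ| * (x + H) + 1)) ^ e * √(x + H - x + 2 / |γ|)) := by
          rw [hB]
          exact hsmooth r q W γ x (x + H) B hq hγ (by linarith) hW
      _ ≤ C * |B| * (4 ^ e * √2 * Z) := by
          refine mul_le_mul_of_nonneg_left ?_ (by positivity)
          exact rpow_mul_sqrt_le_rpow_mul_rpow_half (Nat.cast_nonneg q) hγ0 hW.pos.le hx hHX hγH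
            (by positivity)
      _ = A * Z := by rw [← mul_assoc]
  have hedge : ‖S - shortExpSum g x H (r / q + γ)‖ ≤ |B| * Y := by
    rw [hB]
    exact hW.norm_sum_sub_shortExpSum_le hH0.le hg.divisor_bound _
  have hY : 0 ≤ Y := add_nonneg (divisorSum_nonneg _ _ _) (divisorSum_nonneg _ _ _)
  calc _ = ‖S - (S - shortExpSum g x H (r / q + γ))‖ := by rw [sub_sub_cancel]
    _ ≤ A * Z + |B| * Y := (norm_sub_le _ _).trans (add_le_add hS hedge)
    _ ≤ (A + |B| + 1) * Z + (A + |B| + 1) * Y := by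
        have hA : 0 ≤ A := by positivity
        gcongr <;> linarith [abs_nonneg B]
    _ = _ := by rw [← mul_add]

theorem one_div_le_rpow_of_le_mul_rpow {ε η H γ : ℝ} (hε : 0 ≤ ε) (hη : η ≤ 1) (hH : 1 ≤ H)
    (hγH : 2 ≤ |γ| * H ^ (η - ε / 2)) :
    γ ≠ 0 ∧ 2 / |γ| ≤ H ∧ 1 / |γ| ≤ H ^ (η - ε / 2) ∧ 1 / |γ| ≤ H ^ η := by
  have hγ : γ ≠ 0 := by
    rintro rfl
    norm_num at hγH
  have hγ0 : 0 < |γ| := abs_pos.mpr hγ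
  have htwo : 2 / |γ| ≤ H ^ (η - ε / 2) := (div_le_iff₀' hγ0).mpr hγH
  have hone : 1 / |γ| ≤ H ^ (η - ε / 2) := le_trans (by gcongr; exact one_le_two) htwo
  exact ⟨hγ, htwo.trans (Real.rpow_le_self_of_one_le hH (by linarith)), hone,
    hone.trans (Real.rpow_le_rpow_of_exponent_le hH (by linarith))⟩

theorem mainTheorem1_general (k : ℕ) (g : ArithmeticFunction ℂ) (ε : ℝ) (hε : 0 < ε) :
    (∀ α : ℝ, 0 ≤ α → α < 1 → ClassF k α g →
      ∃ C : ℝ, 0 < C ∧ ∀ (η X x H γ : ℝ) (a : ℤ) (q : ℕ), η ≤ 1 → 0 < q →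
        X ≤ x → x ≤ 2 * X → 1 ≤ H → H ≤ X → 2 ≤ |γ| * H ^ (η - ε / 2) →
        ‖shortExpSum g x H (a / q + γ)‖ ≤
          C * ((q * |γ| * X) ^ ((1 + α) / 2 + ε ^ 2) * H ^ (1 / 2 : ℝ)
            + (divisorSum k (x - H ^ η) x + divisorSum k (x + H) (x + H + H ^ η)))) ∧
    (ClassF k 0 g →
      ∃ C : ℝ, 0 < C ∧ ∀ (j : ℕ) (η X x H γ : ℝ) (a : ℤ) (q : ℕ), η ≤ 1 → 0 < q →
        X ≤ x → x ≤ 2 * X → 1 ≤ H → H ≤ X → 2 ≤ |γ| * H ^ (η - ε / 2) →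
        ‖shortExpSum g x H (a / q + γ)‖ ≤
          C * ((q * |γ| * X) ^ (1 / 2 + ε ^ 2) * H ^ (1 / 2 : ℝ) + H ^ η * Real.log X ^ j)) := by
  constructor
  · intro α hα0 hα1 hg
    obtain ⟨C, hC, hbound⟩ := hg.exists_norm_shortExpSum_le hα0 hα1 (sq_pos_of_pos hε)
    refine ⟨C, hC, fun η X x H γ a q hη hq hXx hx hH hHX hγH => ?_⟩
    obtain ⟨hγ, hγ2, -, hγη⟩ := one_div_le_rpow_of_le_mul_rpow hε.le hη hH hγH
    refine (hbound X x H γ a q hq hXx hx hHX hγ hγ2).trans ?_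
    gcongr <;> exact divisorSum_mono k (by linarith) (by linarith)
  · intro hg
    obtain ⟨C, hC, hbound⟩ := hg.exists_norm_shortExpSum_le le_rfl one_pos (sq_pos_of_pos hε)
    obtain ⟨D, hD, hedge⟩ := exists_divisorSum_add_divisorSum_le_log k hε
    refine ⟨C * (1 + D), by positivity, fun j η X x H γ a q hη hq hXx hx hH hHX hγH => ?_⟩
    obtain ⟨hγ, hγ2, hγη, -⟩ := one_div_le_rpow_of_le_mul_rpow hε.le hη hH hγH
    have hlog := Real.log_nonneg (hH.trans hHX)
    have hmain := hbound X x H γ a q hq hXx hx hHX hγ hγ2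
    rw [add_zero] at hmain
    have hX := rpow_half_le_rpow_mul_rpow_half (Nat.one_le_cast.mpr hq) (abs_nonneg γ) hHX
      (one_le_two.trans ((div_le_iff₀' (abs_pos.mpr hγ)).mp hγ2)) (sq_nonneg ε)
    set Z := (q * |γ| * X) ^ (1 / 2 + ε ^ 2) * H ^ (1 / 2 : ℝ)
    set L := H ^ η * Real.log X ^ j
    have hL : 0 ≤ L := by positivity
    calc _ ≤ C * (Z + D * (X ^ (1 / 2 : ℝ) + L)) := hmain.trans (by
          gcongr
          exact hedge j η X x H (1 / |γ|) hη hXx hx hH hHX (by positivity) hγη)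
      _ ≤ C * ((Z + L) + D * (Z + L)) := by
          gcongr
          exact le_add_of_nonneg_right hL
      _ = _ := by ring

theorem mainTheorem1 (k : ℕ) (hk : 1 ≤ k) (g : ArithmeticFunction ℂ) (ε : ℝ) (hε : 0 < ε) :
    (∀ α : ℝ, 0 ≤ α → α < 1 → ClassF k α g →
      ∃ C K : ℝ, 0 < C ∧ 0 < K ∧
        ∀ (η X x H γ : ℝ) (a q : ℕ), 0 < η → η < 1 → a < q → (q : ℝ) < X →
          X ≤ x → x ≤ 2 * X → 1 ≤ H → H ≤ X → |γ| < 1 → K ≤ |γ| * H ^ (η - ε / 2) →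
          ‖shortExpSum g x H ((a : ℝ) / (q : ℝ) + γ)‖ ≤
            C * (((q : ℝ) * |γ| * X) ^ ((1 + α) / 2 + ε ^ 2) * H ^ ((1 : ℝ) / 2)
              + (divisorSum k (x - H ^ η) x + divisorSum k (x + H) (x + H + H ^ η)))) ∧
    (ClassF k 0 g →
      ∃ C K : ℝ, 0 < C ∧ 0 < K ∧
        ∀ (η X x H γ : ℝ) (a q : ℕ), 0 < η → η < 1 → a < q → (q : ℝ) < X →
          X ≤ x → x ≤ 2 * X → 1 ≤ H → H ≤ X → |γ| < 1 → K ≤ |γ| * H ^ (η - ε / 2) →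
          ‖shortExpSum g x H ((a : ℝ) / (q : ℝ) + γ)‖ ≤
            C * (((q : ℝ) * |γ| * X) ^ ((1 : ℝ) / 2 + ε ^ 2) * H ^ ((1 : ℝ) / 2)
              + H ^ η * Real.log X ^ (k ^ 2 - 1))) := by
  obtain ⟨ha, hb⟩ := mainTheorem1_general k g ε hε
  refine ⟨fun α hα0 hα1 hg => ?_, fun hg => ?_⟩
  · obtain ⟨C, hC, h⟩ := ha α hα0 hα1 hg
    exact ⟨C, 2, hC, two_pos, fun η X x H γ a q _ hη haq _ hXx hx hH hHX _ hγ =>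
      h η X x H γ a q hη.le (Nat.zero_lt_of_lt haq) hXx hx hH hHX hγ⟩
  · obtain ⟨C, hC, h⟩ := hb hg
    exact ⟨C, 2, hC, two_pos, fun η X x H γ a q _ hη haq _ hXx hx hH hHX _ hγ =>
      h _ η X x H γ a q hη.le (Nat.zero_lt_of_lt haq) hXx hx hH hHX hγ⟩
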